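/- Let $k$ be an algebraically closed field of characteristic $p>0$, $p\neq 2$, let $\mathbf F_p\subset k$ be its prime field, and let $\mathbf H_1=\mathbf H(1,0)$ be the $k$-algebra generated by $X,X^{-1},s,y$ with relations $XX^{-1}=X^{-1}X=1$, $sX=X^{-1}s$, $s^2=1$, $sy+ys=0$, $XyX^{-1}=y-1$ (the rank one trigonometric Cherednik algebra with $t=1$ and coupling constant $0$). Indices of basis vectors below are taken modulo $p$. The following formulas define $\mathbf H_1$-modules. (1) For $\mu,d\in k$ with $\mu\notin\mathbf F_p$ and $d\neq 0$: the $2p$-dimensional module $V_{1,1}^{\mu,d}$ with basis $\{v_{\mu+j},v_{-\mu+j}: j\in\mathbf F_p\}$ and $$y v_\beta=\beta v_\beta,\quad X v_\beta=s v_{-\beta-1}\qquad(\beta\in\pm\mu+\mathbf F_p),$$ $$s v_{-\mu-j}=-\tfrac{1}{\mu+j}v_{\mu+j},\quad s v_{\mu+j}=-(\mu+j)v_{-\mu-j}\qquad(j=1,\dots,p-1),$$ $$s v_{-\mu}=-\tfrac d\mu v_\mu,\quad s v_\mu=-\tfrac\mu d v_{-\mu}.$$ (2) For $c,\theta\in\{1,-1\}$: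 the $p$-dimensional module $V_{1,6}^{c,\theta}$ with basis $\{v_j: j\in\mathbf F_p\}$ and $$y v_j=j v_j,\quad s v_0=c v_0,\quad s v_j=-j v_{-j},\quad s v_{-j}=-\tfrac1j v_j\qquad(1\le j\le\tfrac{p-1}2),$$ $$X v_j=s v_{-j-1}\ \ (j\neq\tfrac{p-1}2),\qquad X v_{\frac{p-1}2}=\theta\, s v_{\frac{p-1}2}.$$ (3) For $a\in k$: the $2p$-dimensional module $V_{1,7}^{a}$ with basis $\{v_j,u_j: j\in\mathbf F_p\}$ and $$y v_j=j v_j,\quad y u_j=j u_j,\quad s v_0=v_0,\quad s u_0=a v_0-u_0,$$ $$s v_{-j}=-\tfrac1j v_j,\quad s v_j=-j v_{-j},\quad s u_j=\tfrac1j u_{-j},\quad s u_{-j}=j u_j\qquad(1\le j\le\tfrac{p-1}2),$$ $$X v_j=s v_{-j-1},\quad X u_j=s u_{-j-1}\ \ (j\neq\tfrac{p-1}2),\qquad X v_{\frac{p-1}2}=s u_{\frac{p-1}2},\quad X u_{\frac{p-1}2}=s v_{\frac{p-1}2}.$$ Then all modules $V_{1,1}^{\mu,d}$ and $V_{1,6}^{c,\theta}$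 are irreducible, $V_{1,7}^a$ is irreducible if and only if $a\neq\pm2$, and every irreducible $\mathbf H_1$-module is isomorphic to some $V_{1,1}^{\mu,d}$ ($\mu\notin\mathbf F_p$, $d\ne0$), some $V_{1,6}^{c,\theta}$ ($c,\theta=\pm1$), or some $V_{1,7}^a$ ($a\neq\pm 2$). Moreover: - $V_{1,1}^{\mu,d}\cong V_{1,1}^{\mu',d'}$ if and only if ($\mu'-\mu\in\mathbf F_p$ and $d'=d$) or ($\mu'+\mu\in\mathbf F_p$ and $dd'=\prod_{c\in\mathbf F_p}\bigl(-(\mu+c)^2\bigr)$); - $V_{1,6}^{c,\theta}\cong V_{1,6}^{c',\theta'}$ if and only if $c=c'$ and $\theta=\theta'$; - $V_{1,7}^{a}\cong V_{1,7}^{a'}$ if and only if $a=a'$ (for all $a,a'\in k$); - modules from two different families (1), (2), (3) are never isomorphic. -/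

import Mathlib

universe u v

set_option linter.unusedSectionVars false

noncomputable section

/-- The generators `X`, `X⁻¹`, `s`, `y` of the trigonometric Cherednik algebra of rank one. -/
inductive CherednikGen : Type
  | X
  | Xinv
  | s
  | y

section Algebra

variable {K : Type u} [Field K]

/-- A generator, as an element of the free algebra. -/
def cherednikFree (K : Type u) [Field K] (g : CherednikGen) : FreeAlgebra K CherednikGen :=
  FreeAlgebra.ι K g

/-- The defining relations of the trigonometric Cherednik algebra of rank one. -/
inductive CherednikRel (t k : K) :
    FreeAlgebra K CherednikGen → FreeAlgebra K CherednikGen → Prop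
  | X_mul_Xinv : CherednikRel t k (cherednikFree K .X * cherednikFree K .Xinv) 1
  | Xinv_mul_X : CherednikRel t k (cherednikFree K .Xinv * cherednikFree K .X) 1
  | s_mul_X : CherednikRel t k (cherednikFree K .s * cherednikFree K .X)
      (cherednikFree K .Xinv * cherednikFree K .s)
  | s_sq : CherednikRel t k (cherednikFree K .s * cherednikFree K .s) 1
  | s_y : CherednikRel t k
      (cherednikFree K .s * cherednikFree K .y + cherednikFree K .y * cherednikFree K .s)
      (-algebraMap K _ k)
  | X_y : CherednikRel t k
      (cherednikFree K .X * cherednikFree K .y * cherednikFree K .Xinv)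
      (cherednikFree K .y - algebraMap K _ t + k • cherednikFree K .s)

/-- The trigonometric Cherednik algebra `H(t, k)` of rank one over `K`: the `K`-algebra generated
by `X, X⁻¹, s, y` subject to `s X = X⁻¹ s`, `s² = 1`, `s y + y s = -k`,
`X y X⁻¹ = y - t + k s`. -/
def TrigCherednik (t k : K) : Type u := RingQuot (CherednikRel t k)

instance (t k : K) : Ring (TrigCherednik t k) :=
  inferInstanceAs (Ring (RingQuot (CherednikRel t k)))

instance (t k : K) : Algebra K (TrigCherednik t k) :=
  inferInstanceAs (Algebra K (RingQuot (CherednikRel t k)))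

/-- The images of the generators in `End M`: `X⁻¹` has to act as `s X s`. -/
def cherednikOps {M : Type v} [AddCommGroup M] [Module K M] (s X y : Module.End K M) :
    CherednikGen → Module.End K M
  | .X => X
  | .Xinv => s * X * s
  | .s => s
  | .y => y

/-- The representation of `H(t, k)` on `M` in which `s, X, y` act by three given operators that
satisfy the relations. -/
def cherednikRep (t k : K) {M : Type v} [AddCommGroup M] [Module K M] (s X y : Module.End K M)
    (hs : s * s = 1) (hX : (s * X) * (s * X) = 1)
    (hsy : s * y + y * s = -algebraMap K (Module.End K M) k)
    (hXy : X * y = (y - algebraMap K (Module.End K M) t + k • s) * X) :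
    TrigCherednik t k →ₐ[K] Module.End K M :=
  RingQuot.liftAlgHom K ⟨FreeAlgebra.lift K (cherednikOps s X y), by
    have h1 : X * (s * X * s) = 1 := by
      calc X * (s * X * s) = (s * s) * X * (s * X * s) := by rw [hs, one_mul]
        _ = s * ((s * X) * (s * X)) * s := by noncomm_ring
        _ = 1 := by rw [hX, mul_one, hs]
    intro a b hab
    induction hab with
    | X_mul_Xinv => simpa [cherednikFree, cherednikOps] using h1
    | Xinv_mul_X => simpa [cherednikFree, cherednikOps, mul_assoc] using hX
    | s_mul_X => simp [cherednikFree, cherednikOps, mul_assoc, hs]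
    | s_sq => simpa [cherednikFree, cherednikOps] using hs
    | s_y => simpa [cherednikFree, cherednikOps] using hsy
    | X_y =>
      have h2 : X * y * (s * X * s) = y - algebraMap K (Module.End K M) t + k • s := by
        rw [hXy, mul_assoc, h1, mul_one]
      simpa [cherednikFree, cherednikOps] using h2⟩

end Algebra

section Modules

variable (p : ℕ) [Fact p.Prime] {K : Type u} [Field K] [CharP K p]

/-- The inclusion of the prime field `𝔽_p` into `K`. -/
def fpCast (K : Type u) [Field K] [CharP K p] : ZMod p →+* K := ZMod.castHom dvd_rfl K

/-! ### The modules `V_{1,1}^{μ,d}`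

Basis: `.inl j` is `v_{μ+j}` and `.inr j` is `v_{-μ+j}`, for `j ∈ 𝔽_p`. -/

/-- `y v_β = β v_β`. -/
def v11y (μ : K) : Module.End K (ZMod p ⊕ ZMod p →₀ K) :=
  Finsupp.linearCombination K fun
    | .inl j => (μ + fpCast p K j) • Finsupp.single (.inl j) 1
    | .inr j => (-μ + fpCast p K j) • Finsupp.single (.inr j) 1

/-- For `j ≠ 0`: `s v_{μ+j} = -(μ+j) v_{-μ-j}` and `s v_{-μ-j} = -(μ+j)⁻¹ v_{μ+j}`; moreover
`s v_μ = -(μ/d) v_{-μ}` and `s v_{-μ} = -(d/μ) v_μ`. -/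
def v11s (μ d : K) : Module.End K (ZMod p ⊕ ZMod p →₀ K) :=
  Finsupp.linearCombination K fun
    | .inl j => if j = 0 then -(μ / d) • Finsupp.single (.inr 0) 1
        else -(μ + fpCast p K j) • Finsupp.single (.inr (-j)) 1
    | .inr i => if i = 0 then -(d / μ) • Finsupp.single (.inl 0) 1
        else -(1 / (μ + fpCast p K (-i))) • Finsupp.single (.inl (-i)) 1

/-- `X v_β = s v_{-β-1}`. -/
def v11X (μ d : K) : Module.End K (ZMod p ⊕ ZMod p →₀ K) :=
  Finsupp.linearCombination K fun
    | .inl j => v11s p μ d (Finsupp.single (.inr (-j - 1)) 1)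
    | .inr j => v11s p μ d (Finsupp.single (.inl (-j - 1)) 1)

/-- The underlying vector space of `V_{1,1}^{μ,d}`, for `μ ∉ 𝔽_p` and `d ≠ 0`. -/
def V11 (μ d : K) (_hμ : μ ∉ Set.range (fpCast p K)) (_hd : d ≠ 0) : Type u :=
  ZMod p ⊕ ZMod p →₀ K

/-! ### The modules `V_{1,6}^{c,θ}`

Basis: `v_j`, for `j ∈ 𝔽_p`. The indices `1, …, (p-1)/2` are those with
`j ≠ 0` and `j.val ≤ (p-1)/2`. -/

/-- `y v_j = j v_j`. -/
def v16y (K : Type u) [Field K] [CharP K p] : Module.End K (ZMod p →₀ K) :=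
  Finsupp.linearCombination K fun j => fpCast p K j • Finsupp.single j 1

/-- `s v_0 = c v_0`, and `s v_j = -j v_{-j}`, `s v_{-j} = -j⁻¹ v_j` for `j = 1, …, (p-1)/2`. -/
def v16s (K : Type u) [Field K] [CharP K p] (c : ℤˣ) : Module.End K (ZMod p →₀ K) :=
  Finsupp.linearCombination K fun i =>
    if i = 0 then ((c : ℤ) : K) • Finsupp.single 0 1
    else if i.val ≤ (p - 1) / 2 then -(fpCast p K i) • Finsupp.single (-i) 1
    else -(1 / fpCast p K (-i)) • Finsupp.single (-i) 1

/-- `X v_j = s v_{-j-1}` for `j ≠ (p-1)/2`, and `X v_j = θ s v_j` for `j = (p-1)/2`. -/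
def v16X (K : Type u) [Field K] [CharP K p] (c θ : ℤˣ) : Module.End K (ZMod p →₀ K) :=
  Finsupp.linearCombination K fun j =>
    if j = ((p - 1) / 2 : ℕ) then ((θ : ℤ) : K) • v16s p K c (Finsupp.single j 1)
    else v16s p K c (Finsupp.single (-j - 1) 1)

/-- The underlying vector space of `V_{1,6}^{c,θ}`, for `c, θ ∈ {1, -1}` and `p` odd. -/
def V16 (K : Type u) [Field K] (_hp : p ≠ 2) (_c _θ : ℤˣ) : Type u := ZMod p →₀ K

/-! ### The modules `V_{1,7}^a`

Basis: `.inl j` is `v_j` and `.inr j` is `u_j`, for `j ∈ 𝔽_p`. -/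

/-- `y v_j = j v_j` and `y u_j = j u_j`. -/
def v17y (K : Type u) [Field K] [CharP K p] : Module.End K (ZMod p ⊕ ZMod p →₀ K) :=
  Finsupp.linearCombination K fun
    | .inl j => fpCast p K j • Finsupp.single (.inl j) 1
    | .inr j => fpCast p K j • Finsupp.single (.inr j) 1

/-- `s v_0 = v_0`, `s u_0 = a v_0 - u_0`, and for `j = 1, …, (p-1)/2`: `s v_j = -j v_{-j}`,
`s v_{-j} = -j⁻¹ v_j`, `s u_j = j⁻¹ u_{-j}`, `s u_{-j} = j u_j`. -/
def v17s (a : K) : Module.End K (ZMod p ⊕ ZMod p →₀ K) :=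
  Finsupp.linearCombination K fun
    | .inl i =>
      if i = 0 then Finsupp.single (.inl 0) 1
      else if i.val ≤ (p - 1) / 2 then -(fpCast p K i) • Finsupp.single (.inl (-i)) 1
      else -(1 / fpCast p K (-i)) • Finsupp.single (.inl (-i)) 1
    | .inr i =>
      if i = 0 then a • Finsupp.single (.inl 0) 1 - Finsupp.single (.inr 0) 1
      else if i.val ≤ (p - 1) / 2 then (1 / fpCast p K i) • Finsupp.single (.inr (-i)) 1
      else fpCast p K (-i) • Finsupp.single (.inr (-i)) 1

/-- `X v_j = s v_{-j-1}` and `X u_j = s u_{-j-1}` for `j ≠ (p-1)/2`, while `X v_j = s u_j` and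
`X u_j = s v_j` for `j = (p-1)/2`. -/
def v17X (a : K) : Module.End K (ZMod p ⊕ ZMod p →₀ K) :=
  Finsupp.linearCombination K fun
    | .inl j =>
      if j = ((p - 1) / 2 : ℕ) then v17s p a (Finsupp.single (.inr j) 1)
      else v17s p a (Finsupp.single (.inl (-j - 1)) 1)
    | .inr j =>
      if j = ((p - 1) / 2 : ℕ) then v17s p a (Finsupp.single (.inl j) 1)
      else v17s p a (Finsupp.single (.inr (-j - 1)) 1)

/-- The underlying vector space of `V_{1,7}^a`, for `p` odd. -/
def V17 (_hp : p ≠ 2) (_a : K) : Type u := ZMod p ⊕ ZMod p →₀ K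

/-! ### The operators satisfy the relations of `H(1, 0)` -/

theorem fpCast_injective : Function.Injective (fpCast p K) := (fpCast p K).injective

variable {p}

theorem fp_add_ne {μ : K} (hμ : μ ∉ Set.range (fpCast p K)) (j : ZMod p) :
    μ + fpCast p K j ≠ 0 := by
  intro h
  exact hμ ⟨-j, by rw [map_neg]; linear_combination -h⟩

theorem fp_ne {μ : K} (hμ : μ ∉ Set.range (fpCast p K)) : μ ≠ 0 := by
  simpa using fp_add_ne hμ 0

/-- `X y = (y - 1) X` follows from `A² = 1`, `A y = (-y - 1) A` and `s y = - y s`,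
where `X = s A`. -/
theorem X_y_of_A {M : Type v} [AddCommGroup M] [Module K M] {s A y : Module.End K M}
    (hsy : s * y + y * s = 0) (hAy : A * y = (-y - 1) * A) :
    s * A * y = (y - algebraMap K (Module.End K M) 1 + (0 : K) • s) * (s * A) := by
  have h : s * y = -(y * s) := eq_neg_of_add_eq_zero_left hsy
  rw [mul_assoc, hAy, map_one, zero_smul, add_zero, ← mul_assoc, ← mul_assoc, mul_sub, mul_neg, h,
    sub_mul y 1 s, mul_one, one_mul, neg_neg]

/-- The representation with `X = s A`. -/
def repOfA {M : Type v} [AddCommGroup M] [Module K M] (s A y X : Module.End K M)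
    (hX : X = s * A) (hs : s * s = 1) (hA : A * A = 1) (hsy : s * y + y * s = 0)
    (hAy : A * y = (-y - 1) * A) : TrigCherednik (1 : K) 0 →ₐ[K] Module.End K M :=
  cherednikRep 1 0 s X y hs
    (by rw [hX, ← mul_assoc s s A, hs, one_mul, hA])
    (by rw [hsy, map_zero, neg_zero])
    (by rw [hX]; exact X_y_of_A hsy hAy)

theorem end_ext_single {ι : Type*} {f g : Module.End K (ι →₀ K)}
    (h : ∀ i, f (Finsupp.single i 1) = g (Finsupp.single i 1)) : f = g :=
  Finsupp.lhom_ext' fun i => LinearMap.ext_ring (h i)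

/-- The operator `A = s X` on `V_{1,1}`: `A v_β = v_{-β-1}`. -/
def v11A (p : ℕ) (K : Type u) [Field K] : Module.End K (ZMod p ⊕ ZMod p →₀ K) :=
  Finsupp.linearCombination K fun
    | .inl j => Finsupp.single (.inr (-j - 1)) 1
    | .inr j => Finsupp.single (.inl (-j - 1)) 1

theorem v11X_eq (μ d : K) : v11X p μ d = v11s p μ d * v11A p K := by
  refine end_ext_single fun i => ?_
  rcases i with j | j <;> simp [v11X, v11A]

theorem v11s_sq {μ d : K} (hμ : μ ∉ Set.range (fpCast p K)) (hd : d ≠ 0) :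
    v11s p μ d * v11s p μ d = 1 := by
  have h0 := fp_ne hμ
  refine end_ext_single fun i => ?_
  rcases i with j | j <;> by_cases hj : j = 0
  · subst hj
    simp [v11s, -Finsupp.smul_single, smul_smul]
    field_simp
    simp
  · have := fp_add_ne hμ j
    simp [v11s, hj, -neg_add_rev, -Finsupp.smul_single, smul_smul, this]
  · subst hj
    simp [v11s, -Finsupp.smul_single, smul_smul]
    field_simp
    simp
  · have := fp_add_ne hμ (-j)
    rw [map_neg] at this
    simp [v11s, hj, -neg_add_rev, -Finsupp.smul_single, smul_smul, this]

theorem v11A_sq : v11A p K * v11A p K = 1 := by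
  refine end_ext_single fun i => ?_
  rcases i with j | j <;> simp [v11A]

theorem v11s_y (μ d : K) : v11s p μ d * v11y p μ + v11y p μ * v11s p μ d = 0 := by
  refine end_ext_single fun i => ?_
  rcases i with j | j <;> by_cases hj : j = 0 <;>
    simp [v11s, v11y, hj, -Finsupp.smul_single] <;> module

theorem v11A_y (μ : K) : v11A p K * v11y p μ = (-v11y p μ - 1) * v11A p K := by
  refine end_ext_single fun i => ?_
  rcases i with j | j <;> simp [v11A, v11y, -Finsupp.smul_single] <;> module

/-- `V_{1,1}^{μ,d}` as a representation of `H(1, 0)`. -/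
def v11Rep (μ d : K) (hμ : μ ∉ Set.range (fpCast p K)) (hd : d ≠ 0) :
    TrigCherednik (1 : K) 0 →ₐ[K] Module.End K (ZMod p ⊕ ZMod p →₀ K) :=
  repOfA (v11s p μ d) (v11A p K) (v11y p μ) (v11X p μ d) (v11X_eq μ d) (v11s_sq hμ hd) v11A_sq
    (v11s_y μ d) (v11A_y μ)

theorem half_add (hp : p ≠ 2) : -(((p - 1) / 2 : ℕ) : ZMod p) - 1 = ((p - 1) / 2 : ℕ) := by
  have hodd : Odd p := (Fact.out : p.Prime).odd_of_ne_two hp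
  obtain ⟨m, rfl⟩ := hodd
  have h : (2 * m + 1 - 1) / 2 = m := by omega
  have h2 : ((2 * m + 1 : ℕ) : ZMod (2 * m + 1)) = 0 := ZMod.natCast_self _
  push_cast at h2
  rw [h]
  linear_combination -h2

theorem half_ne (hp : p ≠ 2) {j : ZMod p} (hj : j ≠ ((p - 1) / 2 : ℕ)) :
    -j - 1 ≠ (((p - 1) / 2 : ℕ) : ZMod p) := by
  intro h
  apply hj
  rw [← half_add hp, ← h]
  ring

theorem val_neg_le (hp : p ≠ 2) {i : ZMod p} (hi : i ≠ 0) :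
    (-i).val ≤ (p - 1) / 2 ↔ ¬ i.val ≤ (p - 1) / 2 := by
  have hodd : Odd p := (Fact.out : p.Prime).odd_of_ne_two hp
  obtain ⟨m, hm⟩ := hodd
  have := ZMod.val_lt i
  have h0 : 0 < i.val := Nat.pos_of_ne_zero fun h => hi ((ZMod.val_eq_zero i).1 h)
  rw [ZMod.neg_val, if_neg hi]
  omega

theorem fp_ne_zero {i : ZMod p} (hi : i ≠ 0) : fpCast p K i ≠ 0 :=
  (map_ne_zero_iff _ (fpCast_injective p)).2 hi

theorem signCast_mul_self (c : ℤˣ) : ((c : ℤ) : K) * ((c : ℤ) : K) = 1 := by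
  rw [← Int.cast_mul, Int.units_coe_mul_self, Int.cast_one]

/-- The operator `A = s X` on `V_{1,6}`. -/
def v16A (p : ℕ) (K : Type u) [Field K] (θ : ℤˣ) : Module.End K (ZMod p →₀ K) :=
  Finsupp.linearCombination K fun j =>
    if j = ((p - 1) / 2 : ℕ) then ((θ : ℤ) : K) • Finsupp.single j 1
    else Finsupp.single (-j - 1) 1

theorem v16X_eq (c θ : ℤˣ) : v16X p K c θ = v16s p K c * v16A p K θ := by
  refine end_ext_single fun j => ?_
  by_cases hj : j = ((p - 1) / 2 : ℕ) <;> simp [v16X, v16A, hj, -Finsupp.smul_single]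

theorem v16s_sq (hp : p ≠ 2) (c : ℤˣ) : v16s p K c * v16s p K c = 1 := by
  refine end_ext_single fun j => ?_
  by_cases hj : j = 0
  · subst hj; simp [v16s, signCast_mul_self, smul_smul, -Finsupp.smul_single]
  · have h := fp_ne_zero (K := K) hj
    by_cases hv : j.val ≤ (p - 1) / 2
    · simp [v16s, hj, hv, val_neg_le hp hj, h]
    · simp [v16s, hj, hv, val_neg_le hp hj, h]

theorem v16A_sq (hp : p ≠ 2) (θ : ℤˣ) : v16A p K θ * v16A p K θ = 1 := by
  refine end_ext_single fun j => ?_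
  by_cases hj : j = ((p - 1) / 2 : ℕ)
  · simp [v16A, hj, signCast_mul_self, smul_smul, -Finsupp.smul_single]
  · simp [v16A, hj, half_ne hp hj]

theorem v16s_y (c : ℤˣ) : v16s p K c * v16y p K + v16y p K * v16s p K c = 0 := by
  refine end_ext_single fun j => ?_
  by_cases hj : j = 0
  · subst hj; simp [v16s, v16y]
  · by_cases hv : j.val ≤ (p - 1) / 2 <;>
      simp [v16s, v16y, hj, hv]

theorem fp_half (hp : p ≠ 2) :
    -fpCast p K ((p - 1) / 2 : ℕ) - 1 = fpCast p K ((p - 1) / 2 : ℕ) := by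
  conv_rhs => rw [← half_add hp]
  rw [map_sub, map_neg, map_one]

theorem v16A_y (hp : p ≠ 2) (θ : ℤˣ) :
    v16A p K θ * v16y p K = (-v16y p K - 1) * v16A p K θ := by
  refine end_ext_single fun j => ?_
  by_cases hj : j = ((p - 1) / 2 : ℕ)
  · have h := fp_half (K := K) hp
    rw [← hj] at h
    simp only [v16A, v16y, Module.End.mul_apply, Finsupp.linearCombination_single, one_smul,
      map_smul, if_pos hj, LinearMap.sub_apply, LinearMap.neg_apply, Module.End.one_apply]
    conv_lhs => rw [← h]
    module
  · simp [v16A, v16y, hj]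

/-- `V_{1,6}^{c,θ}` as a representation of `H(1, 0)`. -/
def v16Rep (K : Type u) [Field K] [CharP K p] (hp : p ≠ 2) (c θ : ℤˣ) :
    TrigCherednik (1 : K) 0 →ₐ[K] Module.End K (ZMod p →₀ K) :=
  repOfA (v16s p K c) (v16A p K θ) (v16y p K) (v16X p K c θ) (v16X_eq c θ) (v16s_sq hp c)
    (v16A_sq hp θ) (v16s_y c) (v16A_y hp θ)

/-- The operator `A = s X` on `V_{1,7}`. -/
def v17A (p : ℕ) (K : Type u) [Field K] : Module.End K (ZMod p ⊕ ZMod p →₀ K) :=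
  Finsupp.linearCombination K fun
    | .inl j => if j = ((p - 1) / 2 : ℕ) then Finsupp.single (.inr j) 1
        else Finsupp.single (.inl (-j - 1)) 1
    | .inr j => if j = ((p - 1) / 2 : ℕ) then Finsupp.single (.inl j) 1
        else Finsupp.single (.inr (-j - 1)) 1

theorem v17X_eq (a : K) : v17X p a = v17s p a * v17A p K := by
  refine end_ext_single fun i => ?_
  rcases i with j | j <;> by_cases hj : j = ((p - 1) / 2 : ℕ) <;> simp [v17X, v17A, hj]

theorem v17s_sq (hp : p ≠ 2) (a : K) : v17s p a * v17s p a = 1 := by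
  refine end_ext_single fun i => ?_
  rcases i with j | j <;> by_cases hj : j = 0
  · subst hj; simp [v17s]
  · have h := fp_ne_zero (K := K) hj
    by_cases hv : j.val ≤ (p - 1) / 2 <;> simp [v17s, hj, hv, val_neg_le hp hj, h]
  · subst hj
    simp only [v17s, Module.End.mul_apply, Finsupp.linearCombination_single, one_smul, map_smul,
      if_pos, map_sub, Module.End.one_apply]
    module
  · have h := fp_ne_zero (K := K) hj
    by_cases hv : j.val ≤ (p - 1) / 2 <;> simp [v17s, hj, hv, val_neg_le hp hj, h]

theorem v17A_sq (hp : p ≠ 2) : v17A p K * v17A p K = 1 := by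
  refine end_ext_single fun i => ?_
  rcases i with j | j <;> by_cases hj : j = ((p - 1) / 2 : ℕ)
  · simp [v17A, hj]
  · simp [v17A, hj, half_ne hp hj]
  · simp [v17A, hj]
  · simp [v17A, hj, half_ne hp hj]

theorem v17s_y (a : K) : v17s p a * v17y p K + v17y p K * v17s p a = 0 := by
  refine end_ext_single fun i => ?_
  rcases i with j | j <;> by_cases hj : j = 0
  · subst hj; simp [v17s, v17y]
  · by_cases hv : j.val ≤ (p - 1) / 2 <;>
      simp [v17s, v17y, hj, hv]
  · subst hj; simp [v17s, v17y]
  · by_cases hv : j.val ≤ (p - 1) / 2 <;>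
      simp [v17s, v17y, hj, hv]

theorem v17A_y (hp : p ≠ 2) : v17A p K * v17y p K = (-v17y p K - 1) * v17A p K := by
  refine end_ext_single fun i => ?_
  rcases i with j | j <;> by_cases hj : j = ((p - 1) / 2 : ℕ)
  · have h := fp_half (K := K) hp
    rw [← hj] at h
    simp only [v17A, v17y, Module.End.mul_apply, Finsupp.linearCombination_single, one_smul,
      map_smul, if_pos hj, LinearMap.sub_apply, LinearMap.neg_apply, Module.End.one_apply]
    conv_lhs => rw [← h]
    module
  · simp [v17A, v17y, hj]
  · have h := fp_half (K := K) hp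
    rw [← hj] at h
    simp only [v17A, v17y, Module.End.mul_apply, Finsupp.linearCombination_single, one_smul,
      map_smul, if_pos hj, LinearMap.sub_apply, LinearMap.neg_apply, Module.End.one_apply]
    conv_lhs => rw [← h]
    module
  · simp [v17A, v17y, hj]

/-- `V_{1,7}^a` as a representation of `H(1, 0)`. -/
def v17Rep (hp : p ≠ 2) (a : K) :
    TrigCherednik (1 : K) 0 →ₐ[K] Module.End K (ZMod p ⊕ ZMod p →₀ K) :=
  repOfA (v17s p a) (v17A p K) (v17y p K) (v17X p a) (v17X_eq a) (v17s_sq hp a) (v17A_sq hp)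
    (v17s_y a) (v17A_y hp)

/-! ### The `H(1, 0)`-module structures -/

section V11

variable (μ d : K) (hμ : μ ∉ Set.range (fpCast p K)) (hd : d ≠ 0)

instance : AddCommGroup (V11 p μ d hμ hd) :=
  inferInstanceAs (AddCommGroup (ZMod p ⊕ ZMod p →₀ K))

instance : Module K (V11 p μ d hμ hd) :=
  inferInstanceAs (Module K (ZMod p ⊕ ZMod p →₀ K))

instance : Module (TrigCherednik (1 : K) 0) (V11 p μ d hμ hd) :=
  Module.compHom (ZMod p ⊕ ZMod p →₀ K) (v11Rep μ d hμ hd).toRingHom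

instance : IsScalarTower K (TrigCherednik (1 : K) 0) (V11 p μ d hμ hd) where
  smul_assoc r h v := LinearMap.congr_fun (map_smul (v11Rep μ d hμ hd) r h) v

end V11

section V16

variable (hp : p ≠ 2) (c θ : ℤˣ)

instance : AddCommGroup (V16 p K hp c θ) :=
  inferInstanceAs (AddCommGroup (ZMod p →₀ K))

instance : Module K (V16 p K hp c θ) :=
  inferInstanceAs (Module K (ZMod p →₀ K))

instance : Module (TrigCherednik (1 : K) 0) (V16 p K hp c θ) :=
  Module.compHom (ZMod p →₀ K) (v16Rep K hp c θ).toRingHom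

instance : IsScalarTower K (TrigCherednik (1 : K) 0) (V16 p K hp c θ) where
  smul_assoc r h v := LinearMap.congr_fun (map_smul (v16Rep K hp c θ) r h) v

end V16

section V17

variable (hp : p ≠ 2) (a : K)

instance : AddCommGroup (V17 p hp a) :=
  inferInstanceAs (AddCommGroup (ZMod p ⊕ ZMod p →₀ K))

instance : Module K (V17 p hp a) :=
  inferInstanceAs (Module K (ZMod p ⊕ ZMod p →₀ K))

instance : Module (TrigCherednik (1 : K) 0) (V17 p hp a) :=
  Module.compHom (ZMod p ⊕ ZMod p →₀ K) (v17Rep hp a).toRingHom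

instance : IsScalarTower K (TrigCherednik (1 : K) 0) (V17 p hp a) where
  smul_assoc r h v := LinearMap.congr_fun (map_smul (v17Rep hp a) r h) v

end V17

end Modules

end

/-! Put `A = s X`. Then `s² = A² = 1`, `s y = -y s` and `A y = (-y - 1) A`. On weights (eigenvalues
of `y`), `s` is the reflection about `0`, `A` the reflection about `-1/2`, and `X = s A` the shift
by `1`. In characteristic `p`, `X ^ p` commutes with `y`, while `s X ^ p s = X ^ (-p)`.

The elements `(y ^ p - y) ^ 2` and `X ^ p + X ^ (-p)` are central, and the algebra is a finite
module over the subalgebra they generate. By Nakayama and the Nullstellensatz simple modules are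
therefore finite-dimensional (`finite_of_isSimpleModule_H`), so each contains a weight vector `w`
with `X ^ p w = l w`.

If the weight `μ` of `w` is not in `𝔽_p`, the reflections fix no weight, the `2p` weights `±μ + 𝔽_p`
are distinct, and `μ` and `l` determine the module; `d` is `l` times an explicit product
(`monodromy_mul`, `exists_hom_V11`). The only freedom is to choose another weight vector, which
shifts `μ` by `𝔽_p` or replaces `(μ, l)` by `(-μ, l⁻¹)`.

If the weight is in `𝔽_p`, it can be moved to `0`. Now `A` fixes the weight `-1/2 = (p-1)/2`, and
conjugation by `X ^ ((p-1)/2)` turns `A` there into `s X ^ p` on weight `0` (`A_X_pow_half`). So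
everything is encoded in the weight space `0` with the two involutions `s` and `s X ^ p`, a
representation of the infinite dihedral group. Dimension one gives the signs `c, θ`; dimension two,
with distinct `X ^ p`-eigenvalues `l, l⁻¹`, gives `a = -(l + l⁻¹)`. At `a = ±2` one has `l = ∓1` and
the two-dimensional representation is reducible. Such data produce homomorphisms (`exists_hom_V16`,
`exists_hom_V17`), and between simple modules it is enough that these are nonzero. -/

noncomputable section

/-! ### Generators and relations -/

namespace RankOne

/-- The algebra `H(1, 0)`. -/
abbrev H (K : Type u) [Field K] : Type u := TrigCherednik (1 : K) 0

section Generators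

variable {K : Type u} [Field K]

/-- The image of a generator in `H(1, 0)`. -/
def gen (K : Type u) [Field K] (g : CherednikGen) : H K :=
  RingQuot.mkAlgHom K (CherednikRel (1 : K) 0) (FreeAlgebra.ι K g)

/-- The element `s X` of `H(1, 0)`. -/
def sX (K : Type u) [Field K] : H K := gen K .s * gen K .X

theorem gen_rel {a b : FreeAlgebra K CherednikGen} (h : CherednikRel (1 : K) 0 a b) :
    RingQuot.mkAlgHom K (CherednikRel (1 : K) 0) a =
      RingQuot.mkAlgHom K (CherednikRel (1 : K) 0) b :=
  RingQuot.mkAlgHom_rel K h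

theorem X_mul_Xinv : gen K .X * gen K .Xinv = 1 := by
  have h := gen_rel (CherednikRel.X_mul_Xinv (t := (1 : K)) (k := 0))
  rw [map_mul, map_one] at h
  exact h

theorem Xinv_mul_X : gen K .Xinv * gen K .X = 1 := by
  have h := gen_rel (CherednikRel.Xinv_mul_X (t := (1 : K)) (k := 0))
  rw [map_mul, map_one] at h
  exact h

theorem s_mul_X : gen K .s * gen K .X = gen K .Xinv * gen K .s := by
  have h := gen_rel (CherednikRel.s_mul_X (t := (1 : K)) (k := 0))
  rw [map_mul, map_mul] at h
  exact h

theorem s_mul_s : gen K .s * gen K .s = 1 := by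
  have h := gen_rel (CherednikRel.s_sq (t := (1 : K)) (k := 0))
  rw [map_mul, map_one] at h
  exact h

theorem s_mul_y : gen K .s * gen K .y = -(gen K .y * gen K .s) := by
  have h := gen_rel (CherednikRel.s_y (t := (1 : K)) (k := 0))
  rw [map_add, map_mul, map_mul, map_zero, neg_zero, map_zero] at h
  exact eq_neg_of_add_eq_zero_left h

theorem X_mul_y : gen K .X * gen K .y = (gen K .y - 1) * gen K .X := by
  have h := gen_rel (CherednikRel.X_y (t := (1 : K)) (k := 0))
  rw [zero_smul, add_zero, map_one, map_mul, map_mul, map_sub, map_one] at h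
  have h' : gen K .X * gen K .y * gen K .Xinv = gen K .y - 1 := h
  rw [← h', mul_assoc, Xinv_mul_X, mul_one]

theorem s_mul_sX : gen K .s * sX K = gen K .X := by
  rw [sX, ← mul_assoc, s_mul_s, one_mul]

theorem sX_mul_sX : sX K * sX K = 1 := by
  calc sX K * sX K = (gen K .Xinv * gen K .s) * (gen K .s * gen K .X) := by
        rw [← s_mul_X, sX]
    _ = gen K .Xinv * (gen K .s * gen K .s) * gen K .X := by noncomm_ring
    _ = 1 := by rw [s_mul_s, mul_one, Xinv_mul_X]

theorem sX_mul_s : sX K * gen K .s = gen K .Xinv := by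
  rw [sX, s_mul_X, mul_assoc, s_mul_s, mul_one]

theorem sX_mul_y : sX K * gen K .y = (-gen K .y - 1) * sX K := by
  rw [sX, mul_assoc, X_mul_y, ← mul_assoc, mul_sub, s_mul_y]
  noncomm_ring

theorem adjoin_eq_top : Algebra.adjoin K {gen K .s, gen K .X, gen K .y} = ⊤ := by
  rw [eq_top_iff]
  rintro h -
  obtain ⟨a, rfl⟩ := RingQuot.mkAlgHom_surjective K (CherednikRel (1 : K) 0) h
  have hs : gen K .s ∈ Algebra.adjoin K {gen K .s, gen K .X, gen K .y} :=
    Algebra.subset_adjoin (by simp)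
  have hX : gen K .X ∈ Algebra.adjoin K {gen K .s, gen K .X, gen K .y} :=
    Algebra.subset_adjoin (by simp)
  have hy : gen K .y ∈ Algebra.adjoin K {gen K .s, gen K .X, gen K .y} :=
    Algebra.subset_adjoin (by simp)
  induction a using FreeAlgebra.induction with
  | grade0 r =>
    rw [AlgHom.commutes]
    exact Subalgebra.algebraMap_mem _ r
  | grade1 g =>
    cases g with
    | X => exact hX
    | s => exact hs
    | y => exact hy
    | Xinv =>
      have h : gen K .Xinv ∈ Algebra.adjoin K {gen K .s, gen K .X, gen K .y} := by
        rw [← sX_mul_s, sX]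
        exact mul_mem (mul_mem hs hX) hs
      exact h
  | mul a b ha hb =>
    rw [map_mul]
    exact mul_mem ha hb
  | add a b ha hb =>
    rw [map_add]
    exact add_mem ha hb

/-- `X = s (s X)`, so `s`, `s X` and `y` generate. The pair `s`, `s X` is preferred to `s`, `X`
because both are involutions acting on weights by reflections. -/
theorem H_induction {P : H K → Prop} (hK : ∀ r, P (algebraMap K _ r)) (hs : P (gen K .s))
    (hA : P (sX K)) (hy : P (gen K .y)) (hmul : ∀ a b, P a → P b → P (a * b))
    (hadd : ∀ a b, P a → P b → P (a + b)) (h : H K) : P h := by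
  have hh : h ∈ Algebra.adjoin K {gen K .s, gen K .X, gen K .y} := by
    rw [adjoin_eq_top]; trivial
  induction hh using Algebra.adjoin_induction with
  | mem x hx =>
    rcases hx with rfl | rfl | rfl
    · exact hs
    · rw [← s_mul_sX]
      exact hmul _ _ hs hA
    · exact hy
  | algebraMap r => exact hK r
  | add a b _ _ ha hb => exact hadd _ _ ha hb
  | mul a b _ _ ha hb => exact hmul _ _ ha hb

end Generators

/-! ### Weights -/

section Weights

variable {K : Type u} [Field K] {M : Type v} [AddCommGroup M] [Module K M] [Module (H K) M]
  [IsScalarTower K (H K) M]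

theorem smul_comm' (h : H K) (r : K) (m : M) : h • r • m = r • h • m := by
  have : SMulCommClass K (H K) M := IsScalarTower.to_smulCommClass
  exact (smul_comm r h m).symm

theorem s_s (m : M) : gen K .s • gen K .s • m = m := by
  rw [← mul_smul, s_mul_s, one_smul]

theorem A_A (m : M) : sX K • sX K • m = m := by
  rw [← mul_smul, sX_mul_sX, one_smul]

theorem s_A (m : M) : gen K .s • sX K • m = gen K .X • m := by
  rw [← mul_smul, s_mul_sX]

theorem s_X (m : M) : gen K .s • gen K .X • m = sX K • m := by
  rw [← mul_smul, sX]

theorem Xinv_X (m : M) : gen K .Xinv • gen K .X • m = m := by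
  rw [← mul_smul, Xinv_mul_X, one_smul]

theorem X_Xinv (m : M) : gen K .X • gen K .Xinv • m = m := by
  rw [← mul_smul, X_mul_Xinv, one_smul]

theorem A_X (m : M) : sX K • gen K .X • m = gen K .Xinv • sX K • m := by
  rw [← s_A, ← mul_smul (sX K), sX_mul_s]

theorem s_X_pow (n : ℕ) (m : M) :
    gen K .s • gen K .X ^ n • m = gen K .Xinv ^ n • gen K .s • m := by
  induction n generalizing m with
  | zero => simp
  | succ n ih =>
    rw [pow_succ, mul_smul, ih, pow_succ, mul_smul, ← mul_smul (gen K .s), s_mul_X, mul_smul]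

theorem Xinv_pow_X_pow (n : ℕ) (m : M) : gen K .Xinv ^ n • gen K .X ^ n • m = m := by
  induction n generalizing m with
  | zero => simp
  | succ n ih => rw [pow_succ, pow_succ', mul_smul, mul_smul, Xinv_X, ih]

theorem X_pow_Xinv_pow (n : ℕ) (m : M) : gen K .X ^ n • gen K .Xinv ^ n • m = m := by
  induction n generalizing m with
  | zero => simp
  | succ n ih => rw [pow_succ, pow_succ', mul_smul, mul_smul, X_Xinv, ih]

theorem X_pow_injective (n : ℕ) {m m' : M} (h : gen K .X ^ n • m = gen K .X ^ n • m') :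
    m = m' := by
  rw [← Xinv_pow_X_pow (K := K) n m, h, Xinv_pow_X_pow]

theorem X_pow_ne_zero (n : ℕ) {m : M} (h : m ≠ 0) : gen K .X ^ n • m ≠ 0 := fun h0 =>
  h (X_pow_injective n (h0.trans (smul_zero _).symm))

theorem y_s {β : K} {m : M} (h : gen K .y • m = β • m) :
    gen K .y • gen K .s • m = (-β) • gen K .s • m := by
  have := congrArg (gen K .s • ·) h
  simp only [smul_comm', ← mul_smul, s_mul_y, neg_smul] at this ⊢
  rw [← this, neg_neg]

theorem y_A {β : K} {m : M} (h : gen K .y • m = β • m) :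
    gen K .y • sX K • m = (-β - 1) • sX K • m := by
  have := congrArg (sX K • ·) h
  simp only [smul_comm', ← mul_smul, sX_mul_y] at this
  rw [mul_smul, sub_smul, neg_smul, one_smul] at this
  rw [sub_smul, neg_smul, ← this, one_smul]
  abel

theorem y_X {β : K} {m : M} (h : gen K .y • m = β • m) :
    gen K .y • gen K .X • m = (β + 1) • gen K .X • m := by
  have := y_s (y_A h)
  rwa [s_A, show -(-β - 1) = β + 1 by ring] at this

theorem y_X_pow {β : K} {m : M} (h : gen K .y • m = β • m) (n : ℕ) :
    gen K .y • gen K .X ^ n • m = (β + n) • gen K .X ^ n • m := by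
  induction n with
  | zero => simpa using h
  | succ n ih =>
    rw [pow_succ', mul_smul, y_X ih]
    push_cast
    rw [add_assoc]

theorem A_X_pow (n : ℕ) (m : M) :
    sX K • gen K .X ^ n • m = gen K .Xinv ^ n • sX K • m := by
  induction n generalizing m with
  | zero => simp
  | succ n ih => rw [pow_succ, mul_smul, ih, pow_succ, mul_smul, A_X]

/-- A nonzero finite-dimensional module has a weight vector. -/
theorem exists_weight [IsAlgClosed K] [Module.Finite K M] [Nontrivial M] :
    ∃ (β : K) (m : M), m ≠ 0 ∧ gen K .y • m = β • m := by
  have : SMulCommClass K (H K) M := IsScalarTower.to_smulCommClass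
  obtain ⟨β, hβ⟩ := Module.End.exists_eigenvalue (Algebra.lsmul K K M (gen K .y))
  obtain ⟨m, hm⟩ := hβ.exists_hasEigenvector
  exact ⟨β, m, hm.2, hm.apply_eq_smul⟩

/-- `X ^ p` has an eigenvector in every nonzero weight space of a finite-dimensional module. -/
theorem exists_X_pow_eigenvector [IsAlgClosed K] [Module.Finite K M] (p : ℕ) [CharP K p]
    {β : K} {m : M} (hm : m ≠ 0) (hβ : gen K .y • m = β • m) :
    ∃ (l : K) (w : M), w ≠ 0 ∧ gen K .y • w = β • w ∧ gen K .X ^ p • w = l • w := by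
  have : SMulCommClass K (H K) M := IsScalarTower.to_smulCommClass
  let E := Module.End.eigenspace (Algebra.lsmul K K M (gen K .y)) β
  have hE : ∀ w : M, w ∈ E ↔ gen K .y • w = β • w := fun w => Module.End.mem_eigenspace_iff
  -- `X ^ p` shifts weights by `p = 0`, so it preserves the weight space.
  have hst : ∀ w ∈ E, Algebra.lsmul K K M (gen K .X ^ p) w ∈ E := by
    intro w hw
    rw [hE] at hw ⊢
    have := y_X_pow hw p
    rwa [CharP.cast_eq_zero, add_zero] at this
  have : Nontrivial E := ⟨⟨⟨m, (hE m).2 hβ⟩, 0, fun h => hm (congrArg Subtype.val h)⟩⟩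
  obtain ⟨l, hl⟩ := Module.End.exists_eigenvalue ((Algebra.lsmul K K M (gen K .X ^ p)).restrict hst)
  obtain ⟨w, hw⟩ := hl.exists_hasEigenvector
  refine ⟨l, w, fun h => hw.2 (Subtype.ext h), (hE w).1 w.2, ?_⟩
  exact congrArg Subtype.val hw.apply_eq_smul

end Weights

/-! ### Homomorphisms from modules given by operators -/

section Rep

variable {K : Type u} [Field K]

theorem rep_gen {M : Type v} [AddCommGroup M] [Module K M] (s A y X : Module.End K M)
    (hX : X = s * A) (hs : s * s = 1) (hA : A * A = 1) (hsy : s * y + y * s = 0)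
    (hAy : A * y = (-y - 1) * A) (g : CherednikGen) :
    repOfA s A y X hX hs hA hsy hAy (gen K g) = cherednikOps s X y g := by
  refine (RingQuot.liftAlgHom_mkAlgHom_apply K (FreeAlgebra.lift K (cherednikOps s X y))
    (s := CherednikRel (1 : K) 0) _ (FreeAlgebra.ι K g)).trans ?_
  rw [FreeAlgebra.lift_ι_apply]

theorem rep_sX {M : Type v} [AddCommGroup M] [Module K M] (s A y X : Module.End K M)
    (hX : X = s * A) (hs : s * s = 1) (hA : A * A = 1) (hsy : s * y + y * s = 0)
    (hAy : A * y = (-y - 1) * A) :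
    repOfA s A y X hX hs hA hsy hAy (sX K) = A := by
  rw [sX, map_mul, rep_gen, rep_gen]
  change s * X = A
  rw [hX, ← mul_assoc, hs, one_mul]

variable {ι : Type*} {M : Type v} [AddCommGroup M] [Module K M] [Module (H K) M]
  [IsScalarTower K (H K) M]

/-- A linear map that intertwines `s`, `s X` and `y` on a basis intertwines the action of the
algebra. -/
theorem intertwines (ρ : H K →ₐ[K] Module.End K (ι →₀ K)) (φ : (ι →₀ K) →ₗ[K] M)
    (hs : ∀ i, φ (ρ (gen K .s) (Finsupp.single i 1)) = gen K .s • φ (Finsupp.single i 1))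
    (hA : ∀ i, φ (ρ (sX K) (Finsupp.single i 1)) = sX K • φ (Finsupp.single i 1))
    (hy : ∀ i, φ (ρ (gen K .y) (Finsupp.single i 1)) = gen K .y • φ (Finsupp.single i 1))
    (h : H K) (w : ι →₀ K) : φ (ρ h w) = h • φ w := by
  have : SMulCommClass K (H K) M := IsScalarTower.to_smulCommClass
  have ext {g : H K}
      (hg : ∀ i, φ (ρ g (Finsupp.single i 1)) = g • φ (Finsupp.single i 1)) (w : ι →₀ K) :
      φ (ρ g w) = g • φ w := by
    have : φ ∘ₗ ρ g = Algebra.lsmul K K M g ∘ₗ φ :=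
      Finsupp.lhom_ext' fun i => LinearMap.ext_ring (hg i)
    exact LinearMap.congr_fun this w
  induction h using H_induction generalizing w with
  | hK r => rw [AlgHom.commutes, algebraMap_smul, Module.algebraMap_end_apply, map_smul]
  | hs => exact ext hs w
  | hA => exact ext hA w
  | hy => exact ext hy w
  | hmul a b ha hb => rw [map_mul, Module.End.mul_apply, ha, hb, mul_smul]
  | hadd a b ha hb => rw [map_add, LinearMap.add_apply, map_add, ha, hb, add_smul]

end Rep

end RankOne

end

noncomputable section

namespace RankOne

/-! ### Simple modules are finite-dimensional -/

section Finiteness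

/-- A simple module over an algebra that is finite over a polynomial ring with central image is
finite-dimensional. -/
theorem finite_of_isSimpleModule {K : Type u} [Field K] [IsAlgClosed K] {σ : Type*} [Finite σ]
    {B : Type*} [Ring B] [Algebra K B] [Algebra (MvPolynomial σ K) B]
    [IsScalarTower K (MvPolynomial σ K) B] [Module.Finite (MvPolynomial σ K) B]
    (V : Type*) [AddCommGroup V] [Module K V] [Module B V] [IsScalarTower K B V]
    [IsSimpleModule B V] : Module.Finite K V := by
  let : Module (MvPolynomial σ K) V := Module.compHom V (algebraMap (MvPolynomial σ K) B)
  have hsm (z : MvPolynomial σ K) (v : V) : z • v = algebraMap (MvPolynomial σ K) B z • v := rfl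
  have : IsScalarTower (MvPolynomial σ K) B V :=
    ⟨fun z b v => by rw [hsm, Algebra.smul_def, mul_smul]⟩
  have hC (r : K) (v : V) : (MvPolynomial.C r : MvPolynomial σ K) • v = r • v := by
    rw [hsm, ← MvPolynomial.algebraMap_eq, ← IsScalarTower.algebraMap_apply K (MvPolynomial σ K) B,
      algebraMap_smul]
  have := IsSimpleModule.nontrivial B V
  obtain ⟨v, hv⟩ := exists_ne (0 : V)
  -- `V` is cyclic over `B`, hence a quotient of `B`.
  have hfin : Module.Finite (MvPolynomial σ K) V :=
    Module.Finite.of_surjective ((LinearMap.toSpanSingleton B V v).restrictScalars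
      (MvPolynomial σ K)) (IsSimpleModule.toSpanSingleton_surjective B hv)
  have hann : Module.annihilator (MvPolynomial σ K) V ≠ ⊤ := fun h => by
    have h1 : (1 : MvPolynomial σ K) ∈ Module.annihilator (MvPolynomial σ K) V := by
      rw [h]; trivial
    exact hv (by simpa using Module.mem_annihilator.1 h1 v)
  -- A maximal ideal above the annihilator; by the Nullstellensatz it is the ideal of a point `x`.
  obtain ⟨m, hm, hle⟩ := Ideal.exists_le_maximal _ hann
  have hm' := hm
  rw [MvPolynomial.isMaximal_iff_eq_vanishingIdeal_singleton] at hm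
  obtain ⟨x, hx⟩ := hm
  -- `m V` is stable under `B` because polynomials act centrally.
  let N : Submodule B V :=
    { (m • (⊤ : Submodule (MvPolynomial σ K) V)) with
      smul_mem' := fun b w hw => by
        change b • w ∈ m • (⊤ : Submodule (MvPolynomial σ K) V)
        change w ∈ m • (⊤ : Submodule (MvPolynomial σ K) V) at hw
        induction hw using Submodule.smul_induction_on' with
        | smul z hz w hw =>
          have : b • z • w = z • b • w := by
            rw [hsm, hsm, ← mul_smul, ← mul_smul, Algebra.commutes]
          rw [this]
          exact Submodule.smul_mem_smul hz trivial
        | add w _ w' _ h h' =>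
          rw [smul_add]
          exact add_mem h h' }
  -- Nakayama: if `m V = V`, some `r ≡ 1` modulo `m` kills `V`; then `r` lies in the annihilator,
  -- hence in `m`, and so does `1`.
  have hN : N ≠ ⊤ := fun h => by
    have hle' : (⊤ : Submodule (MvPolynomial σ K) V) ≤ m • ⊤ := fun w _ => by
      have : w ∈ N := by rw [h]; trivial
      exact this
    obtain ⟨r, hr, hr0⟩ := Submodule.exists_sub_one_mem_and_smul_eq_zero_of_fg_of_le_smul m ⊤
      hfin.fg_top hle'
    have hrm : r ∈ m := hle (Module.mem_annihilator.2 fun w => hr0 w trivial)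
    apply hm'.ne_top
    rw [Ideal.eq_top_iff_one]
    simpa using sub_mem hrm hr
  have hN0 : N = ⊥ := (eq_bot_or_eq_top N).resolve_right hN
  have hzero (w : V) (hw : w ∈ m • (⊤ : Submodule (MvPolynomial σ K) V)) : w = 0 := by
    have hw' : w ∈ N := hw
    rwa [hN0, Submodule.mem_bot] at hw'
  -- Since `m V = 0`, polynomials act by their values at `x`, so generators over the polynomial ring
  -- already span over `K`.
  have hscalar (z : MvPolynomial σ K) (w : V) : z • w = MvPolynomial.eval x z • w := by
    have hz : z - MvPolynomial.C (MvPolynomial.eval x z) ∈ m := by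
      rw [hx, MvPolynomial.mem_vanishingIdeal_singleton_iff]
      simp [MvPolynomial.aeval_eq_eval]
    have hmem : (z - MvPolynomial.C (MvPolynomial.eval x z)) • w ∈
        m • (⊤ : Submodule (MvPolynomial σ K) V) :=
      Submodule.smul_mem_smul hz (Submodule.mem_top (x := w))
    have h0 := hzero _ hmem
    rw [sub_smul, sub_eq_zero, hC] at h0
    exact h0
  obtain ⟨S, hS⟩ := hfin.fg_top
  refine ⟨S, ?_⟩
  rw [eq_top_iff]
  rintro w -
  have hw : w ∈ Submodule.span (MvPolynomial σ K) (S : Set V) := by rw [hS]; trivial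
  induction hw using Submodule.span_induction with
  | mem w hw => exact Submodule.subset_span hw
  | zero => exact zero_mem _
  | add a b _ _ ha hb => exact add_mem ha hb
  | smul z a _ ha =>
    rw [hscalar]
    exact Submodule.smul_mem _ _ ha

/-- One twisted commutation rule moves `g` past every polynomial in `x`; this is what reorders words
into the form (polynomial in `y`)(polynomial in `X`)(polynomial in `s`). -/
theorem mul_adjoin_singleton {Z B : Type*} [CommRing Z] [Ring B] [Algebra Z B] {g x x' : B}
    (hx' : x' ∈ Algebra.adjoin Z {x}) (h : g * x = x' * g) {f : B}
    (hf : f ∈ Algebra.adjoin Z {x}) : ∃ f' ∈ Algebra.adjoin Z {x}, g * f = f' * g := by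
  induction hf using Algebra.adjoin_induction with
  | mem y hy =>
    rw [Set.mem_singleton_iff] at hy
    subst hy
    exact ⟨x', hx', h⟩
  | algebraMap r => exact ⟨_, Subalgebra.algebraMap_mem _ r, (Algebra.commutes r g).symm⟩
  | add a b _ _ ha hb =>
    obtain ⟨a', ha', ha⟩ := ha
    obtain ⟨b', hb', hb⟩ := hb
    exact ⟨a' + b', add_mem ha' hb', by rw [mul_add, ha, hb, add_mul]⟩
  | mul a b _ _ ha hb =>
    obtain ⟨a', ha', ha⟩ := ha
    obtain ⟨b', hb', hb⟩ := hb
    exact ⟨a' * b', mul_mem ha' hb', by rw [← mul_assoc, ha, mul_assoc, hb, mul_assoc]⟩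

variable {K : Type u} [Field K]

/-- The algebra is finite over any central subalgebra over which `X` and `y` are integral. -/
theorem finite_of_isIntegral (Z : Type*) [CommRing Z] [Algebra K Z] [Algebra Z (H K)]
    [IsScalarTower K Z (H K)] (hy : IsIntegral Z (gen K .y)) (hX : IsIntegral Z (gen K .X))
    (hXinv : gen K .Xinv ∈ Algebra.adjoin Z {gen K .X}) : Module.Finite Z (H K) := by
  have hs : IsIntegral Z (gen K .s) :=
    IsIntegral.of_pow (n := 2) two_pos (by rw [pow_two, s_mul_s]; exact isIntegral_one)
  let P := Algebra.adjoin Z {gen K .y}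
  let Q := Algebra.adjoin Z {gen K .X}
  let R := Algebra.adjoin Z {gen K .s}
  have hyP : gen K .y ∈ P := Algebra.subset_adjoin rfl
  have hXQ : gen K .X ∈ Q := Algebra.subset_adjoin rfl
  have hsR : gen K .s ∈ R := Algebra.subset_adjoin rfl
  -- `W` is spanned by ordered words. It contains `1`; once it is a left ideal it is the whole
  -- algebra.
  let W : Submodule Z (H K) := P.toSubmodule * Q.toSubmodule * R.toSubmodule
  have hmem {a b c : H K} (ha : a ∈ P) (hb : b ∈ Q) (hc : c ∈ R) : a * b * c ∈ W :=
    Submodule.mul_mem_mul (Submodule.mul_mem_mul ha hb) hc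
  have hstab {g : H K} (hg : ∀ a ∈ P, ∀ b ∈ Q, ∀ c ∈ R, g * (a * b * c) ∈ W) :
      ∀ w ∈ W, g * w ∈ W := by
    intro w hw
    refine Submodule.mul_induction_on hw (fun d hd c hc => ?_) fun a b ha hb => ?_
    · refine Submodule.mul_induction_on hd (fun a ha b hb => hg a ha b hb c hc) fun a b ha hb => ?_
      rw [add_mul, mul_add]
      exact add_mem ha hb
    · rw [mul_add]
      exact add_mem ha hb
  -- Moving `s` to the right replaces `y` by `-y` and `X` by `X⁻¹`; `hXinv` keeps the second factor
  -- inside `Q`.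
  have hsW : ∀ w ∈ W, gen K .s * w ∈ W := by
    refine hstab fun a ha b hb c hc => ?_
    obtain ⟨a', ha', haa⟩ := mul_adjoin_singleton (neg_mem hyP)
      (s_mul_y.trans (neg_mul _ _).symm) ha
    obtain ⟨b', hb', hbb⟩ := mul_adjoin_singleton hXinv s_mul_X hb
    have : gen K .s * (a * b * c) = a' * b' * (gen K .s * c) := by
      rw [← mul_assoc, ← mul_assoc, haa, mul_assoc a', hbb]
      noncomm_ring
    rw [this]
    exact hmem ha' hb' (mul_mem hsR hc)
  have hXW : ∀ w ∈ W, gen K .X * w ∈ W := by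
    refine hstab fun a ha b hb c hc => ?_
    obtain ⟨a', ha', haa⟩ := mul_adjoin_singleton (sub_mem hyP (one_mem _)) X_mul_y ha
    rw [← mul_assoc, ← mul_assoc, haa, mul_assoc a']
    exact hmem ha' (mul_mem hXQ hb) hc
  have hall (h : H K) : ∀ w ∈ W, h * w ∈ W := by
    induction h using H_induction with
    | hK r =>
      intro w hw
      rw [IsScalarTower.algebraMap_apply K Z (H K), ← Algebra.smul_def]
      exact W.smul_mem _ hw
    | hs => exact hsW
    | hA =>
      intro w hw
      rw [sX, mul_assoc]
      exact hsW _ (hXW _ hw)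
    | hy =>
      refine hstab fun a ha b hb c hc => ?_
      rw [← mul_assoc, ← mul_assoc]
      exact hmem (mul_mem hyP ha) hb hc
    | hmul a b ha hb =>
      intro w hw
      rw [mul_assoc]
      exact ha _ (hb _ hw)
    | hadd a b ha hb =>
      intro w hw
      rw [add_mul]
      exact add_mem (ha _ hw) (hb _ hw)
  have htop : W = ⊤ := by
    rw [eq_top_iff]
    rintro h -
    have := hall h (1 * 1 * 1) (hmem (one_mem _) (one_mem _) (one_mem _))
    simpa using this
  refine ⟨?_⟩
  rw [← htop]
  exact (hy.fg_adjoin_singleton.mul hX.fg_adjoin_singleton).mul hs.fg_adjoin_singleton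

/-- Serves to test centrality: `g` commutes with `f(x)` as soon as `f ∘ r = f`. -/
theorem mul_aeval_of_mul_eq {B : Type*} [Ring B] [Algebra K B] {g x : B} {r : Polynomial K}
    (h : g * x = Polynomial.aeval x r * g) (f : Polynomial K) :
    g * Polynomial.aeval x f = Polynomial.aeval x (f.comp r) * g := by
  induction f using Polynomial.induction_on' with
  | add a b ha hb => rw [map_add, mul_add, ha, hb, Polynomial.add_comp, map_add, add_mul]
  | monomial n c =>
    rw [Polynomial.monomial_comp, Polynomial.aeval_monomial, map_mul, map_pow,
      Polynomial.aeval_C, ← mul_assoc, ← Algebra.commutes, mul_assoc, mul_assoc]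
    congr 1
    exact SemiconjBy.pow_right h n

theorem mem_center_of_commute {z : H K} (hs : gen K .s * z = z * gen K .s)
    (hA : sX K * z = z * sX K) (hy : gen K .y * z = z * gen K .y) :
    z ∈ Subalgebra.center K (H K) := by
  rw [Subalgebra.mem_center_iff]
  intro h
  induction h using H_induction with
  | hK r => exact Algebra.commutes r z
  | hs => exact hs
  | hA => exact hA
  | hy => exact hy
  | hmul a b ha hb => rw [mul_assoc, hb, ← mul_assoc, ha, mul_assoc]
  | hadd a b ha hb => rw [add_mul, mul_add, ha, hb]

/-! ### Two central elements and finiteness over them -/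

variable (p : ℕ) [Fact p.Prime] [CharP K p]

/-- The element `(y ^ p - y) ^ 2`. -/
def centralY (K : Type u) [Field K] : H K := (gen K .y ^ p - gen K .y) ^ 2

/-- The element `X ^ p + X ^ (-p)`. -/
def centralX (K : Type u) [Field K] : H K := gen K .X ^ p + gen K .Xinv ^ p

/-- `s` and `s X` substitute `-y` and `-y - 1` for `y`. The polynomial `T ^ p - T` is additive and
vanishes at `1`, so both substitutions only change its sign, which the square removes. -/
theorem centralY_mem : centralY p K ∈ Subalgebra.center K (H K) := by
  open Polynomial in
  have hC : centralY p K = aeval (gen K .y) ((X ^ p - X : K[X]) ^ 2) := by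
    simp [centralY]
  have h1 : ((X ^ p - X : K[X]) ^ 2).comp (-X) = (X ^ p - X) ^ 2 := by
    have h : (-X : K[X]) ^ p = -X ^ p := by
      have : (0 - X : K[X]) ^ p = 0 ^ p - X ^ p := sub_pow_char _ _
      rwa [zero_sub, zero_pow (Fact.out : p.Prime).ne_zero, zero_sub] at this
    simp only [pow_comp, sub_comp, X_comp, h]
    ring
  have h2 : ((X ^ p - X : K[X]) ^ 2).comp (-X - 1) = (X ^ p - X) ^ 2 := by
    have h : (-X - 1 : K[X]) ^ p = -X ^ p - 1 := by
      have : (0 - (X + 1) : K[X]) ^ p = 0 ^ p - (X + 1) ^ p := sub_pow_char _ _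
      rw [zero_sub, zero_pow (Fact.out : p.Prime).ne_zero, zero_sub, add_pow_char, one_pow] at this
      rw [← neg_add', this, neg_add']
    simp only [pow_comp, sub_comp, X_comp, h]
    ring
  refine mem_center_of_commute ?_ ?_ ?_
  · rw [hC, mul_aeval_of_mul_eq (r := -X) (by simp [s_mul_y]), h1]
  · rw [hC, mul_aeval_of_mul_eq (r := -X - 1) (by simp [sX_mul_y]), h2]
  · rw [hC, mul_aeval_of_mul_eq (r := X) (by simp), comp_X]

theorem X_pow_mul_y : gen K .X ^ p * gen K .y = gen K .y * gen K .X ^ p := by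
  have h (n : ℕ) : gen K .X ^ n * gen K .y = (gen K .y - algebraMap K _ n) * gen K .X ^ n := by
    induction n with
    | zero => simp
    | succ n ih =>
      rw [pow_succ', mul_assoc, ih, ← mul_assoc, mul_sub, X_mul_y, ← Algebra.commutes]
      push_cast
      noncomm_ring
  simpa using h p

theorem Xinv_pow_mul_y : gen K .Xinv ^ p * gen K .y = gen K .y * gen K .Xinv ^ p := by
  have h1 : gen K .Xinv ^ p * gen K .X ^ p = 1 := by
    rw [← Commute.mul_pow (Xinv_mul_X.trans X_mul_Xinv.symm), Xinv_mul_X, one_pow]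
  have h2 : gen K .X ^ p * gen K .Xinv ^ p = 1 := by
    rw [← Commute.mul_pow (X_mul_Xinv.trans Xinv_mul_X.symm), X_mul_Xinv, one_pow]
  calc gen K .Xinv ^ p * gen K .y
      = gen K .Xinv ^ p * (gen K .y * gen K .X ^ p) * gen K .Xinv ^ p := by
        rw [mul_assoc, mul_assoc, h2, mul_one]
    _ = (gen K .Xinv ^ p * gen K .X ^ p) * gen K .y * gen K .Xinv ^ p := by
        rw [← X_pow_mul_y, mul_assoc (gen K .Xinv ^ p) (gen K .X ^ p)]
    _ = gen K .y * gen K .Xinv ^ p := by rw [h1, one_mul]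

theorem s_mul_Xinv : gen K .s * gen K .Xinv = gen K .X * gen K .s := by
  rw [← sX_mul_s, ← mul_assoc, s_mul_sX]

/-- `s` exchanges `X ^ p` and `X ^ (-p)`, and each of them commutes with `X` and `y`. -/
theorem centralX_mem : centralX p K ∈ Subalgebra.center K (H K) := by
  have h1 : gen K .s * centralX p K = centralX p K * gen K .s := by
    have h1 := SemiconjBy.pow_right (s_mul_X (K := K)) p
    have h2 := SemiconjBy.pow_right (s_mul_Xinv (K := K)) p
    rw [centralX, mul_add, add_mul, h1.eq, h2.eq, add_comm]
  have h2 : gen K .X * centralX p K = centralX p K * gen K .X := by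
    have h1 : Commute (gen K .X) (gen K .X ^ p) := Commute.pow_right rfl p
    have h2 : Commute (gen K .X) (gen K .Xinv ^ p) :=
      Commute.pow_right (X_mul_Xinv.trans Xinv_mul_X.symm) p
    exact (h1.add_right h2).eq
  refine mem_center_of_commute h1 ?_ ?_
  · rw [sX, mul_assoc, h2, ← mul_assoc, h1, mul_assoc]
  · rw [centralX, mul_add, add_mul, X_pow_mul_y, Xinv_pow_mul_y]

theorem finite_of_isSimpleModule_H {K : Type u} [Field K] [IsAlgClosed K]
    (p : ℕ) [Fact p.Prime] [CharP K p] (V : Type v) [AddCommGroup V] [Module K V]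
    [Module (H K) V] [IsScalarTower K (H K) V] [IsSimpleModule (H K) V] : Module.Finite K V := by
  -- The two variables go to the two central elements; algebraic independence is not needed.
  let f : MvPolynomial (Fin 2) K →ₐ[K] Subalgebra.center K (H K) :=
    MvPolynomial.aeval ![⟨centralY p K, centralY_mem p⟩, ⟨centralX p K, centralX_mem p⟩]
  let F : MvPolynomial (Fin 2) K →ₐ[K] H K := (Subalgebra.center K (H K)).val.comp f
  let : Algebra (MvPolynomial (Fin 2) K) (H K) :=
    F.toRingHom.toAlgebra' fun c x => (Subalgebra.mem_center_iff.1 (f c).2 x).symm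
  have hF (z : MvPolynomial (Fin 2) K) : algebraMap (MvPolynomial (Fin 2) K) (H K) z = F z := rfl
  have : IsScalarTower K (MvPolynomial (Fin 2) K) (H K) :=
    IsScalarTower.of_algebraMap_eq fun r => by rw [hF, AlgHom.commutes]
  have hY : algebraMap (MvPolynomial (Fin 2) K) (H K) (MvPolynomial.X 0) = centralY p K := by
    simp [hF, F, f]
  have hX : algebraMap (MvPolynomial (Fin 2) K) (H K) (MvPolynomial.X 1) = centralX p K := by
    simp [hF, F, f]
  have hp1 := (Fact.out : p.Prime).one_lt
  have hp0 := (Fact.out : p.Prime).pos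
  open Polynomial in
  have hyint : IsIntegral (MvPolynomial (Fin 2) K) (gen K .y) := by
    refine ⟨(X ^ p - X) ^ 2 - C (MvPolynomial.X 0), ?_, ?_⟩
    · have h : ((X ^ p - X : (MvPolynomial (Fin 2) K)[X])).Monic :=
        monic_X_pow_sub (by rw [degree_X]; exact_mod_cast hp1)
      have h0 : (X ^ p - X : (MvPolynomial (Fin 2) K)[X]).natDegree ≠ 0 := fun h0 => by
        have := congrArg (eval 0) (Monic.natDegree_eq_zero h |>.1 h0)
        simp [hp0.ne'] at this
      refine (h.pow 2).sub_of_left (degree_C_le.trans_lt ?_)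
      rw [← natDegree_pos_iff_degree_pos, h.natDegree_pow]
      omega
    · rw [← aeval_def]
      simp [hY, centralY]
  have hXX : gen K .X ^ p * gen K .Xinv ^ p = 1 := by
    rw [← Commute.mul_pow (X_mul_Xinv.trans Xinv_mul_X.symm), X_mul_Xinv, one_pow]
  open Polynomial in
  have hXint : IsIntegral (MvPolynomial (Fin 2) K) (gen K .X) := by
    -- With `D = X ^ p + X ^ (-p)`, the element `X ^ p` is a root of `T² - D T + 1`.
    refine IsIntegral.of_pow hp0 ⟨X ^ 2 + (1 - X * C (MvPolynomial.X 1)), ?_, ?_⟩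
    · refine monic_X_pow_add (lt_of_le_of_lt (b := 1) ?_ (by norm_num))
      compute_degree
    · rw [← aeval_def]
      simp only [map_add, map_sub, map_mul, map_pow, aeval_X, map_one, aeval_C, hX, centralX,
        mul_add, hXX]
      noncomm_ring
  refine
    have := finite_of_isIntegral (MvPolynomial (Fin 2) K) hyint hXint ?_
    finite_of_isSimpleModule (σ := Fin 2) (B := H K) V
  have hmem : gen K .X ∈ Algebra.adjoin (MvPolynomial (Fin 2) K) {gen K .X} :=
    Algebra.subset_adjoin rfl
  have hD := Subalgebra.algebraMap_mem
    (Algebra.adjoin (MvPolynomial (Fin 2) K) {gen K .X}) (MvPolynomial.X 1)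
  rw [hX] at hD
  -- `D - X ^ p = X ^ (-p)`, so `X⁻¹` is a polynomial in `X` with central coefficients.
  have : gen K .Xinv = gen K .X ^ (p - 1) * (centralX p K - gen K .X ^ p) := by
    obtain ⟨n, rfl⟩ : ∃ n, p = n + 1 := ⟨p - 1, by omega⟩
    have h1 : gen K .X ^ n * gen K .Xinv ^ n = 1 := by
      rw [← Commute.mul_pow (X_mul_Xinv.trans Xinv_mul_X.symm), X_mul_Xinv, one_pow]
    rw [centralX, add_sub_cancel_left, Nat.add_sub_cancel, pow_succ (gen K .Xinv), ← mul_assoc, h1,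
      one_mul]
  rw [this]
  exact mul_mem (pow_mem hmem _) (sub_mem hD (pow_mem hmem _))

end Finiteness

end RankOne

end

noncomputable section

namespace RankOne

/-! ### Cyclic chains -/

section Cyclic

variable {p : ℕ} [Fact p.Prime]

theorem prod_range_zmod {R : Type*} [CommMonoid R] (g : ZMod p → R) (a : ZMod p) :
    ∏ i ∈ Finset.range p, g (a + (i : ZMod p)) = ∏ x, g x := by
  have h : ∏ i ∈ Finset.range p, g (a + (i : ZMod p)) = ∏ x, g (a + x) :=
    Finset.prod_nbij' (fun n => (n : ZMod p)) ZMod.val (by simp)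
      (fun x _ => Finset.mem_range.2 (ZMod.val_lt x))
      (fun n hn => ZMod.val_cast_of_lt (Finset.mem_range.1 hn))
      (fun x _ => ZMod.natCast_zmod_val x) (fun _ _ => rfl)
  rw [h]
  exact Fintype.prod_equiv (Equiv.addLeft a) _ _ fun _ => rfl

variable {K : Type u} [Field K] {M : Type v} [AddCommGroup M] [Module K M] [Module (H K) M]
  [IsScalarTower K (H K) M]

theorem X_pow_of_cyclic {g : ZMod p → K} {f : ZMod p → M}
    (h : ∀ j, gen K .X • f j = g (j + 1) • f (j + 1)) (n : ℕ) (j : ZMod p) :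
    gen K .X ^ n • f j = (∏ i ∈ Finset.range n, g (j + 1 + i)) • f (j + n) := by
  induction n with
  | zero => simp
  | succ n ih =>
    rw [pow_succ', mul_smul, ih, smul_comm', h, smul_smul, Finset.prod_range_succ]
    push_cast
    rw [add_right_comm j 1, add_assoc]

theorem X_pow_p_of_cyclic {g : ZMod p → K} {f : ZMod p → M}
    (h : ∀ j, gen K .X • f j = g (j + 1) • f (j + 1)) (j : ZMod p) :
    gen K .X ^ p • f j = (∏ x, g x) • f j := by
  rw [X_pow_of_cyclic h, prod_range_zmod, CharP.cast_eq_zero, add_zero]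

/-- The cyclic chain `w, X w, X ^ 2 w, …`, normalised by `g`. -/
def cyclicChain (g : ZMod p → K) (w : M) (j : ZMod p) : M :=
  (∏ i ∈ Finset.range j.val, g (1 + i))⁻¹ • gen K .X ^ j.val • w

theorem cyclicChain_zero (g : ZMod p → K) (w : M) : cyclicChain g w 0 = w := by
  simp [cyclicChain]

theorem val_add_one_of_lt {j : ZMod p} (hlt : j.val + 1 < p) : (j + 1).val = j.val + 1 := by
  conv_lhs => rw [← ZMod.natCast_zmod_val j, ← Nat.cast_add_one]
  exact ZMod.val_cast_of_lt hlt

theorem X_cyclicChain_of_lt {g : ZMod p → K} (w : M) {j : ZMod p} (hlt : j.val + 1 < p)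
    (hg : g (j + 1) ≠ 0) :
    gen K .X • cyclicChain g w j = g (j + 1) • cyclicChain g w (j + 1) := by
  rw [cyclicChain, cyclicChain, val_add_one_of_lt hlt, smul_comm', ← mul_smul, ← pow_succ',
    smul_smul, Finset.prod_range_succ, ZMod.natCast_zmod_val, add_comm 1 j, mul_inv_rev,
    mul_inv_cancel_left₀ hg]

theorem X_cyclicChain {g : ZMod p → K} (hg : ∀ j, g j ≠ 0) {w : M}
    (hw : gen K .X ^ p • w = (∏ x, g x) • w) (j : ZMod p) :
    gen K .X • cyclicChain g w j = g (j + 1) • cyclicChain g w (j + 1) := by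
  by_cases hlt : j.val + 1 < p
  · exact X_cyclicChain_of_lt w hlt (hg _)
  -- The wrap-around step `j = p - 1`: the chain closes up exactly because `X ^ p` acts on `w` by
  -- the full product of `g`.
  · have hj : ((j.val : ℕ) : ZMod p) = j := ZMod.natCast_zmod_val j
    have hprod (n : ℕ) : ∏ i ∈ Finset.range n, g (1 + (i : ZMod p)) ≠ 0 :=
      Finset.prod_ne_zero_iff.2 fun i _ => hg _
    have hv : j.val + 1 = p := by
      have := ZMod.val_lt j
      omega
    have hj1 : j + 1 = 0 := by
      conv_lhs => rw [← hj, ← Nat.cast_add_one, hv, CharP.cast_eq_zero]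
    rw [hj1, cyclicChain_zero, cyclicChain, smul_comm', ← mul_smul, ← pow_succ', hv, hw, smul_smul]
    congr 1
    rw [← prod_range_zmod g 1]
    conv_lhs => enter [2, 1, 1]; rw [← hv]
    rw [Finset.prod_range_succ, inv_mul_cancel_left₀ (hprod _), hj, add_comm 1 j, hj1]

theorem y_cyclicChain [CharP K p] {g : ZMod p → K} {w : M} {β : K}
    (hw : gen K .y • w = β • w) (j : ZMod p) :
    gen K .y • cyclicChain g w j = (β + fpCast p K j) • cyclicChain g w j := by
  have hj : (j.val : K) = fpCast p K j := by
    rw [← map_natCast (fpCast p K), ZMod.natCast_zmod_val]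
  rw [cyclicChain, smul_comm', y_X_pow hw, smul_comm, hj]

/-- In a module with an eigenbasis for an operator, a weight vector is supported on the basis
vectors of its weight. -/
theorem weight_eq_of_apply_ne_zero {ι : Type*} {D : Module.End K (ι →₀ K)} {c : ι → K}
    (hD : ∀ i, D (Finsupp.single i 1) = c i • Finsupp.single i 1) {β : K} {w : ι →₀ K}
    (hw : D w = β • w) {i : ι} (hi : w i ≠ 0) : c i = β := by
  classical
  have h : Finsupp.lapply i ∘ₗ D = c i • Finsupp.lapply i := by
    refine Finsupp.lhom_ext' fun j => LinearMap.ext_ring ?_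
    by_cases hij : j = i
    · subst hij
      simp [hD]
    · simp [hD, hij]
  have h1 := LinearMap.congr_fun h w
  simp only [LinearMap.comp_apply, hw, map_smul, LinearMap.smul_apply, Finsupp.lapply_apply,
    smul_eq_mul] at h1
  exact (mul_right_cancel₀ hi h1).symm

end Cyclic

/-! ### The modules `V_{1,1}` -/

section V11

variable {p : ℕ} [Fact p.Prime] {K : Type u} [Field K] [CharP K p]
variable {μ d : K} (hμ : μ ∉ Set.range (fpCast p K)) (hd : d ≠ 0)

/-- The basis vectors of `V_{1,1}`. -/
def e11 (i : ZMod p ⊕ ZMod p) : V11 p μ d hμ hd :=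
  (Finsupp.single i 1 : ZMod p ⊕ ZMod p →₀ K)

/-- The coefficients of `s` on `V_{1,1}`: `s v_{-μ-j} = g j v_{μ+j}`. -/
def g11 (μ d : K) (j : ZMod p) : K := if j = 0 then -(d / μ) else -(1 / (μ + fpCast p K j))

include hμ in
theorem μ_add_ne (j : ZMod p) : μ + fpCast p K j ≠ 0 := fp_add_ne hμ j

include hμ in
theorem neg_μ_add_ne (j : ZMod p) : -μ + fpCast p K j ≠ 0 := fun h =>
  fp_add_ne hμ (-j) (by rw [map_neg]; linear_combination -h)

include hμ hd in
theorem g11_ne_zero (j : ZMod p) : g11 μ d j ≠ 0 := by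
  have h0 := fp_ne hμ
  have h1 := fp_add_ne hμ j
  unfold g11
  split_ifs
  · exact neg_ne_zero.2 (div_ne_zero hd h0)
  · exact neg_ne_zero.2 (one_div_ne_zero h1)

theorem s_e11_inr (j : ZMod p) :
    gen K .s • e11 hμ hd (.inr j) = g11 μ d (-j) • e11 hμ hd (.inl (-j)) := by
  change v11Rep μ d hμ hd (gen K .s) (Finsupp.single (.inr j) 1) =
    g11 μ d (-j) • (Finsupp.single (.inl (-j)) 1 : ZMod p ⊕ ZMod p →₀ K)
  rw [v11Rep, rep_gen]
  by_cases hj : j = 0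
  · subst hj; simp [cherednikOps, v11s, g11]
  · simp [cherednikOps, v11s, g11, hj]

theorem s_e11_inl (j : ZMod p) :
    gen K .s • e11 hμ hd (.inl j) = (g11 μ d j)⁻¹ • e11 hμ hd (.inr (-j)) := by
  have h := congrArg (gen K .s • ·) (s_e11_inr hμ hd (-j))
  simp only [s_s, neg_neg, smul_comm'] at h
  rw [h, inv_smul_smul₀ (g11_ne_zero hμ hd j)]

theorem A_e11_inl (j : ZMod p) :
    sX K • e11 hμ hd (.inl j) = e11 hμ hd (.inr (-j - 1)) := by
  change v11Rep μ d hμ hd (sX K) (Finsupp.single (.inl j) 1) =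
    (Finsupp.single (.inr (-j - 1)) 1 : ZMod p ⊕ ZMod p →₀ K)
  rw [v11Rep, rep_sX]
  simp [v11A]

theorem A_e11_inr (j : ZMod p) :
    sX K • e11 hμ hd (.inr j) = e11 hμ hd (.inl (-j - 1)) := by
  have h := congrArg (sX K • ·) (A_e11_inl hμ hd (-j - 1))
  simp only [A_A] at h
  rw [h, show -(-j - 1) - 1 = j by ring]

/-- The weights of `V_{1,1}`. -/
def wt11 (μ : K) : ZMod p ⊕ ZMod p → K
  | .inl j => μ + fpCast p K j
  | .inr j => -μ + fpCast p K j

theorem v11y_single (i : ZMod p ⊕ ZMod p) :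
    v11y p μ (Finsupp.single i 1) = wt11 μ i • Finsupp.single i 1 := by
  rcases i with j | j <;> simp [v11y, wt11]

theorem y_smul_V11 (w : V11 p μ d hμ hd) : gen K .y • w = v11y p μ w := by
  change v11Rep μ d hμ hd (gen K .y) w = _
  rw [v11Rep, rep_gen]
  rfl

theorem y_e11 (i : ZMod p ⊕ ZMod p) : gen K .y • e11 hμ hd i = wt11 μ i • e11 hμ hd i := by
  rw [y_smul_V11]
  exact v11y_single i

theorem e11_ne_zero (i : ZMod p ⊕ ZMod p) : e11 hμ hd i ≠ 0 := fun h => by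
  have h' : (Finsupp.single i 1 : ZMod p ⊕ ZMod p →₀ K) = 0 := h
  simp at h'

theorem span_e11 : Submodule.span K (Set.range (e11 hμ hd)) = ⊤ := by
  have := (Finsupp.basisSingleOne (R := K) (ι := ZMod p ⊕ ZMod p)).span_eq
  rw [Finsupp.coe_basisSingleOne] at this
  exact this

theorem X_e11_inl (j : ZMod p) :
    gen K .X • e11 hμ hd (.inl j) = g11 μ d (j + 1) • e11 hμ hd (.inl (j + 1)) := by
  rw [← s_A, A_e11_inl, s_e11_inr, show -(-j - 1) = j + 1 by ring]

theorem X_e11_inr (j : ZMod p) : gen K .X • e11 hμ hd (.inr j) =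
    (g11 μ d (-(j + 1)))⁻¹ • e11 hμ hd (.inr (j + 1)) := by
  rw [← s_A, A_e11_inr, s_e11_inl, show -(-j - 1) = j + 1 by ring, neg_add']

/-- The eigenvalue of `X ^ p` on `v_μ`. -/
def monodromy (p : ℕ) [Fact p.Prime] {K : Type u} [Field K] [CharP K p] (μ d : K) : K :=
  ∏ j : ZMod p, g11 μ d j

include hμ in
-- All factors cancel except at `j = 0`, where `g11` carries `d`. This converts between the
-- parameter `d` and the invariant it encodes, the eigenvalue of `X ^ p`.
theorem monodromy_mul : monodromy p μ d * ∏ j : ZMod p, -(μ + fpCast p K j) = d := by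
  rw [monodromy, ← Finset.prod_mul_distrib, Fintype.prod_eq_single 0]
  · have := fp_ne hμ
    simp [g11, this]
  · intro j hj
    have := fp_add_ne hμ j
    rw [g11, if_neg hj]
    field_simp

include hμ hd in
theorem monodromy_ne_zero : monodromy p μ d ≠ 0 :=
  Finset.prod_ne_zero_iff.2 fun j _ => g11_ne_zero hμ hd j

theorem X_pow_e11_inl (j : ZMod p) :
    gen K .X ^ p • e11 hμ hd (.inl j) = monodromy p μ d • e11 hμ hd (.inl j) :=
  X_pow_p_of_cyclic (f := fun j => e11 hμ hd (.inl j)) (X_e11_inl hμ hd) j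

/-- Along the second chain `X` acts by the inverse coefficients, in keeping with `s X s = X⁻¹`. This
is the source of the symmetry `(μ, l) ↦ (-μ, l⁻¹)`. -/
theorem X_pow_e11_inr (j : ZMod p) :
    gen K .X ^ p • e11 hμ hd (.inr j) = (monodromy p μ d)⁻¹ • e11 hμ hd (.inr j) := by
  have h := X_pow_p_of_cyclic (g := fun j => (g11 μ d (-j))⁻¹)
    (f := fun j => e11 hμ hd (.inr j)) (X_e11_inr hμ hd) j
  rw [h, monodromy, Finset.prod_inv_distrib]
  congr 2
  exact Fintype.prod_equiv (Equiv.neg _) _ _ fun _ => rfl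

variable {M : Type v} [AddCommGroup M] [Module K M] [Module (H K) M] [IsScalarTower K (H K) M]

/-- A vector of weight `μ` on which `X ^ p` acts by the monodromy defines a homomorphism. -/
theorem exists_hom_V11 {w : M} (hy : gen K .y • w = μ • w)
    (hX : gen K .X ^ p • w = monodromy p μ d • w) :
    ∃ φ : V11 p μ d hμ hd →ₗ[H K] M, φ (e11 hμ hd (.inl 0)) = w := by
  let c : ZMod p → M := cyclicChain (g11 μ d) w
  have hXc (j : ZMod p) : gen K .X • c j = g11 μ d (j + 1) • c (j + 1) :=
    X_cyclicChain (g11_ne_zero hμ hd) hX j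
  have hyc (j : ZMod p) : gen K .y • c j = (μ + fpCast p K j) • c j := y_cyclicChain hy j
  -- The second half is forced by `A v_β = v_{-β-1}` with `β = μ - j - 1`.
  let f : ZMod p ⊕ ZMod p → M := Sum.elim c fun j => sX K • c (-j - 1)
  let φ : (ZMod p ⊕ ZMod p →₀ K) →ₗ[K] M := Finsupp.linearCombination K f
  have hφ (i : ZMod p ⊕ ZMod p) : φ (Finsupp.single i 1) = f i := by
    simp [φ]
  have hsr (j : ZMod p) : gen K .s • f (.inr j) = g11 μ d (-j) • f (.inl (-j)) := by
    simp only [f, Sum.elim_inl, Sum.elim_inr]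
    rw [s_A, hXc, sub_add_cancel]
  have hsl (j : ZMod p) : gen K .s • f (.inl j) = (g11 μ d j)⁻¹ • f (.inr (-j)) := by
    have h := congrArg (gen K .s • ·) (hsr (-j))
    simp only [s_s, neg_neg, smul_comm'] at h
    rw [h, inv_smul_smul₀ (g11_ne_zero hμ hd j)]
  -- An intertwining relation holds at a basis vector once the generator is given by the same
  -- formula in both modules.
  have key (i j : ZMod p ⊕ ZMod p) (a : K) (h : H K)
      (h1 : h • e11 hμ hd i = a • e11 hμ hd j) (h2 : h • f i = a • f j) :
      φ (v11Rep μ d hμ hd h (Finsupp.single i 1)) = h • φ (Finsupp.single i 1) := by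
    have h1' : v11Rep μ d hμ hd h (Finsupp.single i 1) =
      a • (Finsupp.single j 1 : ZMod p ⊕ ZMod p →₀ K) := h1
    rw [h1', map_smul, hφ, hφ, h2]
  have hint := intertwines (v11Rep μ d hμ hd) φ
    (by
      rintro (j | j)
      · exact key _ _ _ _ (s_e11_inl hμ hd j) (hsl j)
      · exact key _ _ _ _ (s_e11_inr hμ hd j) (hsr j))
    (by
      rintro (j | j)
      · refine key _ _ 1 _ ((A_e11_inl hμ hd j).trans (one_smul _ _).symm) ?_
        simp [f]
      · refine key _ _ 1 _ ((A_e11_inr hμ hd j).trans (one_smul _ _).symm) ?_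
        simp [f, A_A])
    (by
      rintro (j | j)
      · exact key _ _ _ _ (y_e11 hμ hd _) (hyc j)
      · refine key _ _ _ _ (y_e11 hμ hd _) ?_
        simp only [f, Sum.elim_inr]
        rw [y_A (hyc _)]
        congr 1
        simp only [wt11, map_sub, map_neg, map_one]
        ring)
  exact ⟨{ toFun := φ, map_add' := φ.map_add, map_smul' := hint },
    (hφ (.inl 0)).trans (cyclicChain_zero _ _)⟩

theorem fp_two_ne (hp : p ≠ 2) : (2 : ZMod p) ≠ 0 := by
  have : Fact (2 < p) := ⟨lt_of_le_of_ne (Fact.out : p.Prime).two_le hp.symm⟩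
  exact Ring.two_ne_zero (by rwa [ZMod.ringChar_zmod_n])

include hμ in
-- An equality `μ + i = -μ + j` would give `2μ ∈ 𝔽_p`, so `μ ∈ 𝔽_p` as `p` is odd. Hence all weight
-- spaces of `V_{1,1}` are lines.
theorem wt11_injective (hp : p ≠ 2) : Function.Injective (wt11 μ : ZMod p ⊕ ZMod p → K) := by
  have hcross (i j : ZMod p) : μ + fpCast p K i ≠ -μ + fpCast p K j := fun h => by
    have h2 := fp_two_ne hp
    refine hμ ⟨(j - i) / 2, ?_⟩
    have h2' : (2 : K) ≠ 0 := by
      have := (map_ne_zero_iff _ (fpCast_injective (K := K) p)).2 h2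
      rwa [map_ofNat] at this
    rw [map_div₀, map_sub, map_ofNat, div_eq_iff h2']
    linear_combination -h
  rintro (i | i) (j | j) h
  · exact congrArg _ (fpCast_injective p (add_left_cancel h))
  · exact (hcross i j h).elim
  · exact (hcross j i h.symm).elim
  · exact congrArg _ (fpCast_injective p (add_left_cancel h))

theorem eq_smul_e11 (hp : p ≠ 2) {β : K} {w : V11 p μ d hμ hd} (hw0 : w ≠ 0)
    (hw : gen K .y • w = β • w) : ∃ i, ∃ c : K, c ≠ 0 ∧ wt11 μ i = β ∧ w = c • e11 hμ hd i := by
  let w' : ZMod p ⊕ ZMod p →₀ K := w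
  have hw' : v11y p μ w' = β • w' := (y_smul_V11 hμ hd w).symm.trans hw
  obtain ⟨i, hi⟩ := Finsupp.ne_iff.1 (show w' ≠ 0 from hw0)
  have hwt {i : ZMod p ⊕ ZMod p} (hi : w' i ≠ 0) := weight_eq_of_apply_ne_zero v11y_single hw' hi
  refine ⟨i, w' i, hi, hwt hi, ?_⟩
  change w' = w' i • (Finsupp.single i 1 : ZMod p ⊕ ZMod p →₀ K)
  ext j
  by_cases hij : i = j
  · subst hij; simp
  · have : w' j = 0 := by
      by_contra hj
      exact hij (wt11_injective hμ hp ((hwt hi).trans (hwt hj).symm))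
    simp [this, hij]

end V11

end RankOne

end

noncomputable section

namespace RankOne

/-! ### Simplicity -/

section Simplicity

variable {K : Type u} [Field K] {M : Type v} [AddCommGroup M] [Module K M] [Module (H K) M]
  [IsScalarTower K (H K) M]

theorem smul_mem_of_mem (N : Submodule (H K) M) (c : K) {w : M} (hw : w ∈ N) : c • w ∈ N :=
  (N.restrictScalars K).smul_mem c hw

theorem mem_of_smul_mem (N : Submodule (H K) M) {c : K} (hc : c ≠ 0) {w : M} (hw : c • w ∈ N) :
    w ∈ N := by
  have := smul_mem_of_mem N c⁻¹ hw
  rwa [inv_smul_smul₀ hc] at this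

theorem eq_top_of_basis_mem {ι : Type*} {e : ι → M} (he : Submodule.span K (Set.range e) = ⊤)
    {N : Submodule (H K) M} (h : ∀ i, e i ∈ N) : N = ⊤ := by
  have : N.restrictScalars K = ⊤ := by
    rw [eq_top_iff, ← he, Submodule.span_le]
    rintro _ ⟨i, rfl⟩
    exact h i
  exact (Submodule.restrictScalars_eq_top_iff K (H K) M).1 this

theorem exists_weight_mem [IsAlgClosed K] [Module.Finite K M] {N : Submodule (H K) M}
    (hN : N ≠ ⊥) : ∃ (β : K) (w : M), w ∈ N ∧ w ≠ 0 ∧ gen K .y • w = β • w := by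
  have : Nontrivial N := (Submodule.nontrivial_iff_ne_bot).2 hN
  have : Module.Finite K N :=
    Module.Finite.of_injective (N.subtype.restrictScalars K) N.subtype_injective
  obtain ⟨β, w, hw0, hw⟩ := exists_weight (K := K) (M := N)
  exact ⟨β, w, w.2, fun h => hw0 (Subtype.ext h), congrArg Subtype.val hw⟩

/-- A nonzero submodule is finite-dimensional, so it contains a weight vector, and only submodules
containing one need to be tested. -/
theorem isSimpleModule_of_weight [IsAlgClosed K] [Module.Finite K M] [Nontrivial M]
    (h : ∀ (N : Submodule (H K) M) (β : K) (w : M), w ∈ N → w ≠ 0 →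
      gen K .y • w = β • w → N = ⊤) : IsSimpleModule (H K) M := by
  rw [isSimpleModule_iff]
  refine ⟨fun N => ?_⟩
  by_cases hN : N = ⊥
  · exact Or.inl hN
  · obtain ⟨β, w, hw, hw0, hwy⟩ := exists_weight_mem hN
    exact Or.inr (h N β w hw hw0 hwy)

/-- A nonzero homomorphism between simple modules is an isomorphism. -/
theorem nonempty_equiv_of_hom {M' : Type*} [AddCommGroup M'] [Module (H K) M']
    [IsSimpleModule (H K) M] [IsSimpleModule (H K) M'] (φ : M →ₗ[H K] M') {m : M}
    (h : φ m ≠ 0) : Nonempty (M ≃ₗ[H K] M') :=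
  ⟨LinearEquiv.ofBijective φ (LinearMap.bijective_of_ne_zero fun h0 => h (by simp [h0]))⟩

theorem map_smul_field {M' : Type*} [AddCommGroup M'] [Module K M'] [Module (H K) M']
    [IsScalarTower K (H K) M'] (φ : M →ₗ[H K] M') (c : K) (m : M) : φ (c • m) = c • φ m := by
  rw [← algebraMap_smul (H K) c m, map_smul, algebraMap_smul]

end Simplicity

/-! ### The modules `V_{1,1}`: simplicity, isomorphisms, exhaustion -/

section V11

variable {p : ℕ} [Fact p.Prime] {K : Type u} [Field K] [CharP K p]
variable {μ d : K} (hμ : μ ∉ Set.range (fpCast p K)) (hd : d ≠ 0)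

instance : Module.Finite K (V11 p μ d hμ hd) :=
  inferInstanceAs (Module.Finite K (ZMod p ⊕ ZMod p →₀ K))

instance : Nontrivial (V11 p μ d hμ hd) :=
  inferInstanceAs (Nontrivial (ZMod p ⊕ ZMod p →₀ K))

theorem finrank_V11 : Module.finrank K (V11 p μ d hμ hd) = 2 * p := by
  change Module.finrank K (ZMod p ⊕ ZMod p →₀ K) = 2 * p
  simp [ZMod.card, two_mul]

theorem mem_cyclic {M : Type v} [AddCommGroup M] [Module K M] [Module (H K) M]
    [IsScalarTower K (H K) M] {N : Submodule (H K) M} {g : ZMod p → K} (hg : ∀ j, g j ≠ 0)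
    {f : ZMod p → M} (h : ∀ j, gen K .X • f j = g (j + 1) • f (j + 1)) {i : ZMod p}
    (hi : f i ∈ N) (j : ZMod p) : f j ∈ N := by
  have h1 := N.smul_mem (gen K .X ^ (j - i).val) hi
  rw [X_pow_of_cyclic h, ZMod.natCast_zmod_val, add_sub_cancel] at h1
  exact mem_of_smul_mem N (Finset.prod_ne_zero_iff.2 fun _ _ => hg _) h1

/-- The weight spaces are lines, and `X` and `s X` permute them transitively up to nonzero scalars.
-/
theorem isSimpleModule_V11 [IsAlgClosed K] (hp : p ≠ 2) :
    IsSimpleModule (H K) (V11 p μ d hμ hd) := by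
  refine isSimpleModule_of_weight fun N β w hw hw0 hwy => ?_
  obtain ⟨i, c, hc, -, rfl⟩ := eq_smul_e11 hμ hd hp hw0 hwy
  have hi := mem_of_smul_mem N hc hw
  have hl : ∃ j, e11 hμ hd (.inl j) ∈ N := by
    rcases i with j | j
    · exact ⟨j, hi⟩
    · exact ⟨_, (A_e11_inr hμ hd j) ▸ N.smul_mem (sX K) hi⟩
  obtain ⟨j, hj⟩ := hl
  have hall (k : ZMod p) : e11 hμ hd (.inl k) ∈ N :=
    mem_cyclic (f := fun j => e11 hμ hd (.inl j)) (g11_ne_zero hμ hd) (X_e11_inl hμ hd) hj k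
  refine eq_top_of_basis_mem (span_e11 hμ hd) ?_
  rintro (k | k)
  · exact hall k
  · have := N.smul_mem (sX K) (hall (-k - 1))
    rwa [A_e11_inl, show -(-k - 1) - 1 = k by ring] at this

theorem prod_add_shift (μ : K) (j : ZMod p) :
    ∏ c : ZMod p, -(μ + fpCast p K j + fpCast p K c) = ∏ c : ZMod p, -(μ + fpCast p K c) :=
  Fintype.prod_equiv (Equiv.addLeft j) _ _ fun c => by simp [add_assoc]

theorem prod_neg_shift (μ : K) :
    ∏ c : ZMod p, -(-μ + fpCast p K c) = ∏ c : ZMod p, (μ + fpCast p K c) :=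
  Fintype.prod_equiv (Equiv.neg _) _ _ fun c => by simp [add_comm]

/-- The pairs (weight, `X ^ p`-eigenvalue) occurring in `V_{1,1}^{μ,d}` are `(μ + j, l)` and `(-μ +
j, l⁻¹)`, with `l` the monodromy. The modules are isomorphic exactly when the pair of the second
generator occurs in the first; the rest rewrites this in terms of `d`. -/
theorem nonempty_V11_equiv_iff [IsAlgClosed K] (hp : p ≠ 2) {μ' d' : K}
    (hμ' : μ' ∉ Set.range (fpCast p K)) (hd' : d' ≠ 0) :
    Nonempty (V11 p μ d hμ hd ≃ₗ[H K] V11 p μ' d' hμ' hd') ↔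
      (μ' - μ ∈ Set.range (fpCast p K) ∧ d' = d) ∨
      (μ' + μ ∈ Set.range (fpCast p K) ∧ d * d' = ∏ c : ZMod p, -(μ + fpCast p K c) ^ 2) := by
  have hm := monodromy_mul (d := d) hμ
  have hm' := monodromy_mul (d := d') hμ'
  have hm0 := monodromy_ne_zero hμ hd
  have hP : ∏ c : ZMod p, -(μ + fpCast p K c) ≠ 0 := fun h => hd (by rw [← hm, h, mul_zero])
  have hP' : ∏ c : ZMod p, -(μ' + fpCast p K c) ≠ 0 := fun h => hd' (by rw [← hm', h, mul_zero])
  have hsq : ∏ c : ZMod p, -(μ + fpCast p K c) ^ 2 =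
      (∏ c : ZMod p, -(μ + fpCast p K c)) * ∏ c : ZMod p, (μ + fpCast p K c) := by
    rw [← Finset.prod_mul_distrib]
    exact Finset.prod_congr rfl fun c _ => by ring
  have hshift {j : ZMod p} (h : μ + fpCast p K j = μ') :
      ∏ c : ZMod p, -(μ' + fpCast p K c) = ∏ c : ZMod p, -(μ + fpCast p K c) := by
    rw [← h, prod_add_shift]
  have hshift' {j : ZMod p} (h : -μ + fpCast p K j = μ') :
      ∏ c : ZMod p, -(μ' + fpCast p K c) = ∏ c : ZMod p, (μ + fpCast p K c) := by
    rw [← h, prod_add_shift, prod_neg_shift]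
  have hcond : ((∃ j, μ + fpCast p K j = μ') ∧ d' = d ∨
      (∃ j, -μ + fpCast p K j = μ') ∧ d * d' = ∏ c : ZMod p, -(μ + fpCast p K c) ^ 2) ↔
      ((∃ j, μ + fpCast p K j = μ') ∧ monodromy p μ' d' = monodromy p μ d) ∨
      ((∃ j, -μ + fpCast p K j = μ') ∧ monodromy p μ' d' = (monodromy p μ d)⁻¹) := by
    refine or_congr (and_congr_right ?_) (and_congr_right ?_)
    · rintro ⟨j, hj⟩
      conv_rhs => rw [← mul_left_inj' hP', hm', hshift hj, hm]
    -- Here the product in the statement is the product of the two normalising factors, so the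
    -- condition on `d d'` says that the two monodromies multiply to `1`.
    · rintro ⟨j, hj⟩
      rw [hsq, ← hshift' hj, ← mul_eq_one_iff_eq_inv₀ hm0]
      conv_rhs => rw [← mul_left_inj' (mul_ne_zero hP hP'), one_mul]
      have hring (a b c e : K) : a * b * (c * e) = b * c * (a * e) := by ring
      rw [hring, hm, hm']
  have hr1 : (μ' - μ ∈ Set.range (fpCast p K)) ↔ ∃ j, μ + fpCast p K j = μ' :=
    exists_congr fun j => ⟨fun h => by rw [h]; ring, fun h => by rw [← h]; ring⟩
  have hr2 : (μ' + μ ∈ Set.range (fpCast p K)) ↔ ∃ j, -μ + fpCast p K j = μ' :=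
    exists_congr fun j => ⟨fun h => by rw [h]; ring, fun h => by rw [← h]; ring⟩
  rw [hr1, hr2, hcond]
  constructor
  · rintro ⟨e⟩
    have hw0 : e.symm (e11 hμ' hd' (.inl 0)) ≠ 0 := fun h =>
      e11_ne_zero hμ' hd' (.inl 0) (e.symm.map_eq_zero_iff.1 h)
    have hwy : gen K .y • e.symm (e11 hμ' hd' (.inl 0)) = μ' • e.symm (e11 hμ' hd' (.inl 0)) := by
      rw [← map_smul, y_e11, ← LinearEquiv.coe_coe, map_smul_field]
      simp [wt11]
    have hwX : gen K .X ^ p • e.symm (e11 hμ' hd' (.inl 0)) =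
        monodromy p μ' d' • e.symm (e11 hμ' hd' (.inl 0)) := by
      rw [← map_smul, X_pow_e11_inl, ← LinearEquiv.coe_coe, map_smul_field]
    obtain ⟨i, c, hc, hi, hw⟩ := eq_smul_e11 hμ hd hp hw0 hwy
    rw [hw] at hwX hw0
    have hinj {a b : K} (h : a • c • e11 hμ hd i = b • c • e11 hμ hd i) : a = b :=
      smul_left_injective K hw0 h
    rcases i with j | j
    · rw [smul_comm', X_pow_e11_inl, smul_comm c] at hwX
      exact Or.inl ⟨⟨j, hi⟩, (hinj hwX).symm⟩
    · rw [smul_comm', X_pow_e11_inr, smul_comm c] at hwX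
      exact Or.inr ⟨⟨j, hi⟩, (hinj hwX).symm⟩
  · have := isSimpleModule_V11 hμ hd hp
    have := isSimpleModule_V11 hμ' hd' hp
    have hiso {i : ZMod p ⊕ ZMod p} (hi : wt11 μ i = μ')
        (hX : gen K .X ^ p • e11 hμ hd i = monodromy p μ' d' • e11 hμ hd i) :
        Nonempty (V11 p μ d hμ hd ≃ₗ[H K] V11 p μ' d' hμ' hd') := by
      obtain ⟨φ, hφ⟩ := exists_hom_V11 hμ' hd' (hi ▸ y_e11 hμ hd i) hX
      exact (nonempty_equiv_of_hom φ (hφ ▸ e11_ne_zero hμ hd i)).map LinearEquiv.symm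
    rintro (⟨⟨j, hj⟩, h⟩ | ⟨⟨j, hj⟩, h⟩)
    · exact hiso (i := .inl j) hj (by rw [h, X_pow_e11_inl])
    · exact hiso (i := .inr j) hj (by rw [h, X_pow_e11_inr])

/-- A simple module with a weight outside the prime field is some `V_{1,1}`. -/
theorem exists_equiv_V11 [IsAlgClosed K] (hp : p ≠ 2) (V : Type v) [AddCommGroup V] [Module K V]
    [Module (H K) V] [IsScalarTower K (H K) V] [IsSimpleModule (H K) V] [Module.Finite K V]
    (hμ : μ ∉ Set.range (fpCast p K)) {w : V} (hw0 : w ≠ 0) (hw : gen K .y • w = μ • w) :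
    ∃ (d : K) (hd : d ≠ 0), Nonempty (V ≃ₗ[H K] V11 p μ d hμ hd) := by
  obtain ⟨l, w, hw0, hw, hl⟩ := exists_X_pow_eigenvector p hw0 hw
  have hl0 : l ≠ 0 := by
    rintro rfl
    exact X_pow_ne_zero (K := K) p hw0 (hl.trans (zero_smul _ _))
  have hP : ∏ c : ZMod p, -(μ + fpCast p K c) ≠ 0 :=
    Finset.prod_ne_zero_iff.2 fun c _ => neg_ne_zero.2 (fp_add_ne hμ c)
  -- `d` is chosen so that the monodromy of `V_{1,1}^{μ,d}` is `l`.
  have hd : l * ∏ c : ZMod p, -(μ + fpCast p K c) ≠ 0 := mul_ne_zero hl0 hP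
  refine ⟨_, hd, ?_⟩
  have hmon : monodromy p μ (l * ∏ c : ZMod p, -(μ + fpCast p K c)) = l :=
    mul_right_cancel₀ hP (monodromy_mul hμ)
  have := isSimpleModule_V11 hμ hd hp
  obtain ⟨φ, hφ⟩ := exists_hom_V11 hμ hd hw (by rw [hmon, hl])
  exact (nonempty_equiv_of_hom φ (hφ ▸ hw0)).map LinearEquiv.symm

end V11

end RankOne

end

noncomputable section

namespace RankOne

/-! ### Half-chains -/

section HalfChain

variable {p : ℕ} [Fact p.Prime]

theorem two_mul_half_add_one (hp : p ≠ 2) : 2 * ((p - 1) / 2) + 1 = p := by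
  obtain ⟨m, hm⟩ := (Fact.out : p.Prime).odd_of_ne_two hp
  omega

theorem half_pos (hp : p ≠ 2) : 0 < (p - 1) / 2 := by
  have h1 := two_mul_half_add_one hp
  have h2 := (Fact.out : p.Prime).one_lt
  omega

theorem val_half (hp : p ≠ 2) : (((p - 1) / 2 : ℕ) : ZMod p).val = (p - 1) / 2 :=
  ZMod.val_cast_of_lt (by have := two_mul_half_add_one hp; omega)

theorem val_neg_sub_one (j : ZMod p) : (-j - 1).val = p - 1 - j.val := by
  have hlt := ZMod.val_lt j
  have h : ((p - 1 - j.val : ℕ) : ZMod p) = -j - 1 := by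
    rw [Nat.sub_sub, Nat.cast_sub (by omega), CharP.cast_eq_zero]
    push_cast
    rw [ZMod.natCast_zmod_val]
    ring
  rw [← h]
  exact ZMod.val_cast_of_lt (by omega)

variable {K : Type u} [Field K] [CharP K p]
  {M : Type v} [AddCommGroup M] [Module K M] [Module (H K) M] [IsScalarTower K (H K) M]

/-- A family of weight vectors on which `s` acts through the coefficients `g` away from `0` and
`s X` acts by reflecting the index away from `-1/2`. -/
structure IsHalfChain (g : ZMod p → K) (f : ZMod p → M) : Prop where
  y_smul : ∀ j, gen K .y • f j = fpCast p K j • f j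
  s_smul : ∀ j, j ≠ 0 → gen K .s • f j = g (-j) • f (-j)
  A_smul : ∀ j : ZMod p, j ≠ ((p - 1) / 2 : ℕ) → sX K • f j = f (-j - 1)

/-- The product of the coefficients along a half-chain. -/
def halfProd (g : ZMod p → K) : K := ∏ i ∈ Finset.range ((p - 1) / 2), g (1 + i)

theorem halfProd_ne_zero {g : ZMod p → K} (hg : ∀ j, j ≠ 0 → g j ≠ 0) :
    halfProd g ≠ 0 := by
  refine Finset.prod_ne_zero_iff.2 fun i hi => hg _ fun h => ?_
  rw [Finset.mem_range] at hi
  have h1 : ((1 + i : ℕ) : ZMod p) = 0 := by exact_mod_cast h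
  rw [ZMod.natCast_eq_zero_iff] at h1
  have := Nat.le_of_dvd (by omega) h1
  omega

theorem IsHalfChain.X_smul {g : ZMod p → K} {f : ZMod p → M} (hf : IsHalfChain g f) {j : ZMod p}
    (hj : j ≠ ((p - 1) / 2 : ℕ)) (hj1 : j + 1 ≠ 0) :
    gen K .X • f j = g (j + 1) • f (j + 1) := by
  rw [← s_A, hf.A_smul j hj, hf.s_smul _ (by rw [← neg_add']; exact neg_ne_zero.2 hj1)]
  rw [show -(-j - 1) = j + 1 by ring]

/-- In this range no step starts at the fixed weight `-1/2` or ends at `0`, the two places where a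
half-chain leaves the action unspecified. -/
theorem IsHalfChain.X_pow_smul (hp : p ≠ 2) {g : ZMod p → K} {f : ZMod p → M}
    (hf : IsHalfChain g f) (n : ℕ) (hn : n ≤ (p - 1) / 2) :
    gen K .X ^ n • f 0 = (∏ i ∈ Finset.range n, g (1 + i)) • f n := by
  have h2 := two_mul_half_add_one hp
  induction n with
  | zero => simp
  | succ n ih =>
    have h3 : (n : ZMod p) ≠ ((p - 1) / 2 : ℕ) := fun h => by
      have := congrArg ZMod.val h
      rw [val_half hp, ZMod.val_cast_of_lt (by omega)] at this
      omega
    have h4 : (n : ZMod p) + 1 ≠ 0 := fun h => by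
      have := congrArg ZMod.val h
      rw [← Nat.cast_add_one, ZMod.val_cast_of_lt (by omega), ZMod.val_zero] at this
      omega
    rw [pow_succ', mul_smul, ih (by omega), smul_comm', hf.X_smul h3 h4, smul_smul,
      Finset.prod_range_succ, Nat.cast_add_one, add_comm 1 (n : ZMod p)]

theorem IsHalfChain.X_pow_half_smul (hp : p ≠ 2) {g : ZMod p → K} {f : ZMod p → M}
    (hf : IsHalfChain g f) :
    gen K .X ^ ((p - 1) / 2) • f 0 = halfProd g • f ((p - 1) / 2 : ℕ) :=
  hf.X_pow_smul hp _ le_rfl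

/-- Powers of `X` climb from `0` to `(p-1)/2`, and `s` reflects these weights onto the remaining
ones, always with nonzero coefficients. -/
theorem IsHalfChain.mem (hp : p ≠ 2) {g : ZMod p → K} (hg : ∀ j, j ≠ 0 → g j ≠ 0)
    {f : ZMod p → M} (hf : IsHalfChain g f) {N : Submodule (H K) M} (h0 : f 0 ∈ N) (j : ZMod p) :
    f j ∈ N := by
  have h2 := two_mul_half_add_one hp
  have hle (j : ZMod p) (hj : j.val ≤ (p - 1) / 2) : f j ∈ N := by
    have h := hf.X_pow_smul hp _ hj
    rw [ZMod.natCast_zmod_val] at h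
    refine mem_of_smul_mem N (c := ∏ i ∈ Finset.range j.val, g (1 + i)) ?_
      (h ▸ N.smul_mem _ h0)
    refine Finset.prod_ne_zero_iff.2 fun i hi => hg _ fun h => ?_
    rw [Finset.mem_range] at hi
    have h1 : ((1 + i : ℕ) : ZMod p) = 0 := by exact_mod_cast h
    rw [ZMod.natCast_eq_zero_iff] at h1
    have := Nat.le_of_dvd (by omega) h1
    omega
  by_cases hj : j.val ≤ (p - 1) / 2
  · exact hle j hj
  · have hj0 : j ≠ 0 := by
      rintro rfl
      simp at hj
    have h3 := hle (-j) ((val_neg_le hp hj0).2 hj)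
    have h4 := N.smul_mem (gen K .s) h3
    rw [hf.s_smul _ (neg_ne_zero.2 hj0), neg_neg] at h4
    exact mem_of_smul_mem N (hg j hj0) h4

/-- With `h = (p-1)/2`, both sides equal `X ^ (-h-1) s w`. On weight `0` this carries the action of
`A` at its fixed weight `h = -1/2` back to `s X ^ p`. -/
theorem A_X_pow_half (hp : p ≠ 2) (w : M) :
    sX K • gen K .X ^ ((p - 1) / 2) • w =
      gen K .X ^ ((p - 1) / 2) • gen K .s • gen K .X ^ p • w := by
  have h2 := two_mul_half_add_one hp
  have h3 : p = (p - 1) / 2 + ((p - 1) / 2 + 1) := by omega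
  conv_rhs => rw [s_X_pow]; enter [2, 1]; rw [h3]
  rw [pow_add, mul_smul, X_pow_Xinv_pow, pow_succ, mul_smul, A_X_pow, sX, s_mul_X, mul_smul]

/-- The half-chain generated by a vector of weight `0`. -/
def halfChain (g : ZMod p → K) (w : M) (j : ZMod p) : M :=
  if j.val ≤ (p - 1) / 2 then cyclicChain g w j else (g j)⁻¹ • gen K .s • cyclicChain g w (-j)

theorem halfChain_zero (g : ZMod p → K) (w : M) : halfChain g w 0 = w := by
  simp [halfChain, cyclicChain_zero]

/-- The upper half is the normalised `s`-image of the lower half, and `g j * g (-j) = 1` is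
consistency with `s² = 1`. The rule for `s X` comes from a step of `X` on the lower half and from
`(s X)² = 1` on the upper half. -/
theorem isHalfChain_halfChain (hp : p ≠ 2) {g : ZMod p → K}
    (hg : ∀ j, j ≠ 0 → g j * g (-j) = 1) {w : M} (hw : gen K .y • w = 0) :
    IsHalfChain g (halfChain g w) := by
  have h2 := two_mul_half_add_one hp
  have hg0 (j : ZMod p) (hj : j ≠ 0) : g j ≠ 0 := left_ne_zero_of_mul_eq_one (hg j hj)
  have hginv (j : ZMod p) (hj : j ≠ 0) : (g j)⁻¹ = g (-j) := inv_eq_of_mul_eq_one_right (hg j hj)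
  have hy (j : ZMod p) : gen K .y • cyclicChain g w j = fpCast p K j • cyclicChain g w j := by
    have := y_cyclicChain (g := g) (w := w) (β := 0) (by rw [hw, zero_smul]) j
    rwa [zero_add] at this
  have hA (j : ZMod p) (hj : j.val < (p - 1) / 2) :
      sX K • halfChain g w j = halfChain g w (-j - 1) := by
    have hj1 : (j + 1).val = j.val + 1 := val_add_one_of_lt (by omega)
    have hj0 : j + 1 ≠ 0 := fun h => by
      rw [h, ZMod.val_zero] at hj1
      omega
    have h3 : ¬ (-(j + 1)).val ≤ (p - 1) / 2 := by
      rw [val_neg_le hp hj0]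
      omega
    rw [← neg_add', halfChain, halfChain, if_pos hj.le, if_neg h3, neg_neg,
      hginv _ (neg_ne_zero.2 hj0), neg_neg, ← s_X, X_cyclicChain_of_lt w (by omega) (hg0 _ hj0),
      smul_comm']
  refine ⟨fun j => ?_, fun j hj0 => ?_, fun j hj => ?_⟩
  · rw [halfChain]
    split_ifs with h
    · exact hy j
    · rw [smul_comm', y_s (hy (-j)), map_neg, neg_neg, smul_comm]
  · by_cases h : j.val ≤ (p - 1) / 2
    · have h3 : ¬ (-j).val ≤ (p - 1) / 2 := by
        rw [val_neg_le hp hj0]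
        exact not_not.2 h
      rw [halfChain, halfChain, if_pos h, if_neg h3, neg_neg,
        smul_inv_smul₀ (hg0 _ (neg_ne_zero.2 hj0))]
    · have h3 : (-j).val ≤ (p - 1) / 2 := (val_neg_le hp hj0).2 h
      rw [halfChain, halfChain, if_neg h, if_pos h3, smul_comm', s_s, hginv j hj0]
  · by_cases h : j.val < (p - 1) / 2
    · exact hA j h
    · have h3 : j.val ≠ (p - 1) / 2 := fun h => hj (by rw [← h, ZMod.natCast_zmod_val])
      have h4 := hA (-j - 1) (by rw [val_neg_sub_one]; have := half_pos hp; omega)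
      rw [show -(-j - 1) - 1 = j by ring] at h4
      rw [← h4, A_A]

/-- The coefficients of `s` on the half-chain `v_j`. -/
def gv (p : ℕ) [Fact p.Prime] (K : Type u) [Field K] [CharP K p] (j : ZMod p) : K :=
  if j.val ≤ (p - 1) / 2 then -(1 / fpCast p K j) else fpCast p K j

/-- The coefficients of `s` on the half-chain `u_j`. -/
def gu (p : ℕ) [Fact p.Prime] (K : Type u) [Field K] [CharP K p] (j : ZMod p) : K :=
  if j.val ≤ (p - 1) / 2 then fpCast p K j else -(1 / fpCast p K j)

theorem gv_mul (hp : p ≠ 2) (j : ZMod p) (hj : j ≠ 0) : gv p K j * gv p K (-j) = 1 := by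
  have h := fp_ne_zero (K := K) hj
  by_cases hv : j.val ≤ (p - 1) / 2 <;> simp [gv, val_neg_le hp hj, hv, h]

theorem gu_mul (hp : p ≠ 2) (j : ZMod p) (hj : j ≠ 0) : gu p K j * gu p K (-j) = 1 := by
  have h := fp_ne_zero (K := K) hj
  by_cases hv : j.val ≤ (p - 1) / 2 <;> simp [gu, val_neg_le hp hj, hv, h]

theorem gv_ne_zero (hp : p ≠ 2) (j : ZMod p) (hj : j ≠ 0) : gv p K j ≠ 0 :=
  left_ne_zero_of_mul_eq_one (gv_mul hp j hj)

theorem gu_ne_zero (hp : p ≠ 2) (j : ZMod p) (hj : j ≠ 0) : gu p K j ≠ 0 :=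
  left_ne_zero_of_mul_eq_one (gu_mul hp j hj)

/-- Wilson's theorem: the factors of `(p-1)!` above `(p-1)/2` are, modulo `p` and in reverse order,
the negatives of those below. -/
theorem prod_half_mul_prod_neg (hp : p ≠ 2) :
    (∏ i ∈ Finset.range ((p - 1) / 2), ((i : K) + 1)) *
      ∏ i ∈ Finset.range ((p - 1) / 2), -((i : K) + 1) = -1 := by
  have h2 := two_mul_half_add_one hp
  have hw : (((p - 1).factorial : ℕ) : K) = -1 := by
    have := congrArg (fpCast p K) (ZMod.wilsons_lemma p)
    rwa [map_natCast, map_neg, map_one] at this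
  have h0 : ((p : ℕ) : K) = 0 := CharP.cast_eq_zero K p
  rw [show (p - 1).factorial = ((p - 1) / 2 + (p - 1) / 2).factorial by congr 1; omega] at hw
  generalize (p - 1) / 2 = h at h2 hw ⊢
  have h3 : (h : K) + h + 1 = 0 := by
    rw [← h0, ← h2]
    push_cast
    ring
  rw [← hw, ← Finset.prod_range_add_one_eq_factorial, Finset.prod_range_add]
  push_cast
  congr 1
  rw [← Finset.prod_range_reflect (fun x : ℕ => (h : K) + x + 1)]
  refine Finset.prod_congr rfl fun i hi => ?_
  rw [Finset.mem_range] at hi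
  rw [Nat.sub_sub, Nat.cast_sub (by omega)]
  push_cast
  linear_combination -h3

/-- For `1 ≤ i ≤ (p-1)/2` the coefficients are `i` for `gu` and `-1/i` for `gv`, so the quotient of
the products is the Wilson product `-1`. This sign is the one in `s X ^ p v_0 = -u_0`. -/
theorem halfProd_gu (hp : p ≠ 2) : halfProd (gu p K) = -halfProd (gv p K) := by
  have h2 := two_mul_half_add_one hp
  have hval {i : ℕ} (hi : i ∈ Finset.range ((p - 1) / 2)) :
      (1 + (i : ZMod p)).val ≤ (p - 1) / 2 := by
    rw [Finset.mem_range] at hi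
    rw [add_comm, ← Nat.cast_add_one, ZMod.val_cast_of_lt (by omega)]
    omega
  have hu : halfProd (gu p K) = ∏ i ∈ Finset.range ((p - 1) / 2), ((i : K) + 1) :=
    Finset.prod_congr rfl fun i hi => by
      rw [gu, if_pos (hval hi), map_add, map_one, map_natCast, add_comm]
  have hv : halfProd (gv p K) = (∏ i ∈ Finset.range ((p - 1) / 2), -((i : K) + 1))⁻¹ := by
    rw [← Finset.prod_inv_distrib]
    refine Finset.prod_congr rfl fun i hi => ?_
    rw [gv, if_pos (hval hi), map_add, map_one, map_natCast, add_comm, one_div, inv_neg]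
  have h := prod_half_mul_prod_neg (K := K) hp
  rw [hu, hv]
  have h0 := right_ne_zero_of_mul (h.trans_ne (neg_ne_zero.2 one_ne_zero))
  rw [(eq_div_iff h0).2 h, neg_div, one_div]

end HalfChain

end RankOne

end

noncomputable section

namespace RankOne

variable {p : ℕ} [Fact p.Prime] {K : Type u} [Field K] [CharP K p]

/-! ### The modules `V_{1,6}` -/

section V16

variable (hp : p ≠ 2) (c θ : ℤˣ)

instance : Module.Finite K (V16 p K hp c θ) :=
  inferInstanceAs (Module.Finite K (ZMod p →₀ K))

instance : Nontrivial (V16 p K hp c θ) :=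
  inferInstanceAs (Nontrivial (ZMod p →₀ K))

theorem finrank_V16 : Module.finrank K (V16 p K hp c θ) = p := by
  change Module.finrank K (ZMod p →₀ K) = p
  simp [ZMod.card]

/-- The basis vectors of `V_{1,6}`. -/
def e16 (j : ZMod p) : V16 p K hp c θ := (Finsupp.single j 1 : ZMod p →₀ K)

theorem span_e16 : Submodule.span K (Set.range (e16 (K := K) hp c θ)) = ⊤ := by
  have := (Finsupp.basisSingleOne (R := K) (ι := ZMod p)).span_eq
  rw [Finsupp.coe_basisSingleOne] at this
  exact this

theorem e16_ne_zero (j : ZMod p) : e16 (K := K) hp c θ j ≠ 0 := fun h => by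
  have h' : (Finsupp.single j 1 : ZMod p →₀ K) = 0 := h
  simp at h'

theorem y_smul_V16 (w : V16 p K hp c θ) : gen K .y • w = v16y p K w := by
  change v16Rep K hp c θ (gen K .y) w = _
  rw [v16Rep, rep_gen]
  rfl

theorem v16y_single (j : ZMod p) :
    v16y p K (Finsupp.single j 1) = fpCast p K j • Finsupp.single j 1 := by
  simp [v16y]

theorem isHalfChain_e16 : IsHalfChain (gv p K) (e16 (K := K) hp c θ) where
  y_smul j := (y_smul_V16 hp c θ _).trans (v16y_single j)
  s_smul j hj := by
    change v16Rep K hp c θ (gen K .s) (Finsupp.single j 1) =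
      gv p K (-j) • (Finsupp.single (-j) 1 : ZMod p →₀ K)
    rw [v16Rep, rep_gen]
    by_cases hv : j.val ≤ (p - 1) / 2 <;> simp [cherednikOps, v16s, gv, hj, hv, val_neg_le hp hj]
  A_smul j hj := by
    change v16Rep K hp c θ (sX K) (Finsupp.single j 1) = (Finsupp.single (-j - 1) 1 : ZMod p →₀ K)
    rw [v16Rep, rep_sX]
    simp [v16A, hj]

theorem s_e16_zero : gen K .s • e16 (K := K) hp c θ 0 = ((c : ℤ) : K) • e16 hp c θ 0 := by
  change v16Rep K hp c θ (gen K .s) (Finsupp.single 0 1) =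
    ((c : ℤ) : K) • (Finsupp.single 0 1 : ZMod p →₀ K)
  rw [v16Rep, rep_gen]
  simp [cherednikOps, v16s]

theorem A_e16_half : sX K • e16 (K := K) hp c θ ((p - 1) / 2 : ℕ) =
    ((θ : ℤ) : K) • e16 hp c θ ((p - 1) / 2 : ℕ) := by
  change v16Rep K hp c θ (sX K) (Finsupp.single ((p - 1) / 2 : ℕ) 1) =
    ((θ : ℤ) : K) • (Finsupp.single ((p - 1) / 2 : ℕ) 1 : ZMod p →₀ K)
  rw [v16Rep, rep_sX]
  simp [v16A]

theorem y_e16_zero : gen K .y • e16 (K := K) hp c θ 0 = 0 := by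
  rw [(isHalfChain_e16 hp c θ).y_smul, map_zero, zero_smul]

/-- The sign `θ`, defined by `A` at weight `-1/2`, is carried to weight `0` by `A_X_pow_half`. -/
theorem s_X_pow_e16_zero : gen K .s • gen K .X ^ p • e16 (K := K) hp c θ 0 =
    ((θ : ℤ) : K) • e16 hp c θ 0 := by
  apply X_pow_injective (K := K) ((p - 1) / 2)
  have h := (isHalfChain_e16 (K := K) hp c θ).X_pow_half_smul hp
  rw [← A_X_pow_half hp, smul_comm' (gen K .X ^ _) ((θ : ℤ) : K), h, smul_comm', A_e16_half,
    smul_comm ((θ : ℤ) : K)]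

theorem eq_smul_e16 {w : V16 p K hp c θ} {β : K} (hw0 : w ≠ 0) (hw : gen K .y • w = β • w) :
    ∃ j, ∃ a : K, a ≠ 0 ∧ fpCast p K j = β ∧ w = a • e16 hp c θ j := by
  let w' : ZMod p →₀ K := w
  have hw' : v16y p K w' = β • w' := (y_smul_V16 hp c θ w).symm.trans hw
  obtain ⟨i, hi⟩ := Finsupp.ne_iff.1 (show w' ≠ 0 from hw0)
  have hwt {i : ZMod p} (hi : w' i ≠ 0) := weight_eq_of_apply_ne_zero v16y_single hw' hi
  refine ⟨i, w' i, hi, hwt hi, ?_⟩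
  change w' = w' i • (Finsupp.single i 1 : ZMod p →₀ K)
  ext j
  by_cases hij : i = j
  · subst hij; simp
  · have : w' j = 0 := by
      by_contra hj
      exact hij (fpCast_injective p ((hwt hi).trans (hwt hj).symm))
    simp [this, hij]

/-- A nonzero vector of weight in the prime field can be moved to weight `0`. -/
theorem exists_weight_zero {M : Type v} [AddCommGroup M] [Module K M] [Module (H K) M]
    [IsScalarTower K (H K) M] {w : M} {j : ZMod p} (hw : gen K .y • w = fpCast p K j • w) :
    gen K .y • gen K .X ^ (-j).val • w = 0 := by
  have h := y_X_pow hw (-j).val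
  rwa [← map_natCast (fpCast p K), ZMod.natCast_zmod_val, ← map_add, add_neg_cancel, map_zero,
    zero_smul] at h

theorem isSimpleModule_V16 [IsAlgClosed K] : IsSimpleModule (H K) (V16 p K hp c θ) := by
  refine isSimpleModule_of_weight fun N β w hw hw0 hwy => ?_
  obtain ⟨j, a, -, hj, -⟩ := eq_smul_e16 hp c θ hw0 hwy
  have h0 := exists_weight_zero (hj ▸ hwy)
  have hne : gen K .X ^ (-j).val • w ≠ 0 := X_pow_ne_zero _ hw0
  obtain ⟨i, b, hb, hi, he⟩ := eq_smul_e16 hp c θ (β := 0) hne (by rw [h0, zero_smul])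
  rw [map_eq_zero] at hi
  subst hi
  have hmem : e16 hp c θ 0 ∈ N := mem_of_smul_mem N hb (he ▸ N.smul_mem _ hw)
  exact eq_top_of_basis_mem (span_e16 hp c θ)
    ((isHalfChain_e16 hp c θ).mem hp (gv_ne_zero hp) hmem)

variable {M : Type v} [AddCommGroup M] [Module K M] [Module (H K) M] [IsScalarTower K (H K) M]

/-- A vector of weight `0` on which `s` and `s X ^ p` act by signs defines a homomorphism. -/
theorem exists_hom_V16 {w : M} (hy : gen K .y • w = 0) (hs : gen K .s • w = ((c : ℤ) : K) • w)
    (hX : gen K .s • gen K .X ^ p • w = ((θ : ℤ) : K) • w) :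
    ∃ φ : V16 p K hp c θ →ₗ[H K] M, φ (e16 hp c θ 0) = w := by
  let f : ZMod p → M := halfChain (gv p K) w
  have hf0 : f 0 = w := halfChain_zero _ _
  have hf : IsHalfChain (gv p K) f := isHalfChain_halfChain hp (gv_mul hp) hy
  -- `A_X_pow_half` in the other direction: `s X ^ p` on `w` fixes the action of `A` at the end of
  -- the chain.
  have hA : sX K • f ((p - 1) / 2 : ℕ) = ((θ : ℤ) : K) • f ((p - 1) / 2 : ℕ) := by
    have h := hf.X_pow_half_smul hp
    have h2 := A_X_pow_half (K := K) hp (f 0)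
    rw [hf0, hX, ← hf0, smul_comm', h, smul_comm',
      smul_comm ((θ : ℤ) : K) (halfProd (gv p K))] at h2
    exact smul_right_injective M (halfProd_ne_zero (gv_ne_zero hp)) h2
  have he := isHalfChain_e16 (K := K) hp c θ
  let φ : (ZMod p →₀ K) →ₗ[K] M := Finsupp.linearCombination K f
  have hφ (i : ZMod p) : φ (Finsupp.single i 1) = f i := by
    simp [φ]
  have key (i j : ZMod p) (a : K) (h : H K)
      (h1 : h • e16 (K := K) hp c θ i = a • e16 hp c θ j) (h2 : h • f i = a • f j) :
      φ (v16Rep K hp c θ h (Finsupp.single i 1)) = h • φ (Finsupp.single i 1) := by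
    have h1' : v16Rep K hp c θ h (Finsupp.single i 1) =
      a • (Finsupp.single j 1 : ZMod p →₀ K) := h1
    rw [h1', map_smul, hφ, hφ, h2]
  have hint := intertwines (v16Rep K hp c θ) φ
    (fun j => by
      by_cases hj : j = 0
      · subst hj
        exact key _ _ _ _ (s_e16_zero hp c θ) (by rw [hf0, hs])
      · exact key _ _ _ _ (he.s_smul j hj) (hf.s_smul j hj))
    (fun j => by
      by_cases hj : j = ((p - 1) / 2 : ℕ)
      · subst hj
        exact key _ _ _ _ (A_e16_half hp c θ) hA
      · exact key _ _ 1 _ ((he.A_smul j hj).trans (one_smul _ _).symm)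
          ((hf.A_smul j hj).trans (one_smul _ _).symm))
    (fun j => key _ _ _ _ (he.y_smul j) (hf.y_smul j))
  exact ⟨{ toFun := φ, map_add' := φ.map_add, map_smul' := hint }, (hφ 0).trans hf0⟩

theorem two_ne_zero_of_charP (K : Type u) [Field K] [CharP K p] (hp : p ≠ 2) : (2 : K) ≠ 0 := by
  have := (map_ne_zero_iff _ (fpCast_injective (K := K) p)).2 (fp_two_ne hp)
  rwa [map_ofNat] at this

theorem signCast_injective (K : Type u) [Field K] [CharP K p] (hp : p ≠ 2) :
    Function.Injective fun c : ℤˣ => ((c : ℤ) : K) := by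
  have h2 := two_ne_zero_of_charP K hp
  intro c c' h
  rcases Int.units_eq_one_or c with rfl | rfl <;> rcases Int.units_eq_one_or c' with rfl | rfl
  · rfl
  · simp only [Units.val_one, Int.cast_one, Units.val_neg, Int.cast_neg] at h
    exact (h2 (by linear_combination h)).elim
  · simp only [Units.val_one, Int.cast_one, Units.val_neg, Int.cast_neg] at h
    exact (h2 (by linear_combination -h)).elim
  · rfl

/-- The weight space `0` is a line, on which `s` and `s X ^ p` act by `c` and `θ`; signs stay
distinct in `K` since `p` is odd. -/
theorem nonempty_V16_equiv_iff (c' θ' : ℤˣ) :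
    Nonempty (V16 p K hp c θ ≃ₗ[H K] V16 p K hp c' θ') ↔ c = c' ∧ θ = θ' := by
  constructor
  · rintro ⟨e⟩
    have hK (a : K) (w : V16 p K hp c θ) : e (a • w) = a • e w := map_smul_field e.toLinearMap a w
    have hne : e (e16 hp c θ 0) ≠ 0 := fun h =>
      e16_ne_zero hp c θ 0 (e.map_eq_zero_iff.1 h)
    have hy : gen K .y • e (e16 hp c θ 0) = 0 := by
      rw [← map_smul, y_e16_zero, map_zero]
    obtain ⟨j, b, hb, hj, he⟩ := eq_smul_e16 hp c' θ' (β := 0) hne (by rw [hy, zero_smul])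
    rw [map_eq_zero] at hj
    subst hj
    have hs := congrArg e (s_e16_zero (K := K) hp c θ)
    have hX := congrArg e (s_X_pow_e16_zero (K := K) hp c θ)
    rw [map_smul, hK, he, smul_comm', s_e16_zero, smul_comm] at hs
    rw [map_smul, map_smul, hK, he, smul_comm', smul_comm', s_X_pow_e16_zero, smul_comm] at hX
    have hne' : b • e16 hp c' θ' 0 ≠ 0 := he ▸ hne
    exact ⟨(signCast_injective K hp (smul_left_injective K hne' hs)).symm,
      (signCast_injective K hp (smul_left_injective K hne' hX)).symm⟩
  · rintro ⟨rfl, rfl⟩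
    exact ⟨LinearEquiv.refl _ _⟩

end V16

end RankOne

end

noncomputable section

namespace RankOne

variable {p : ℕ} [Fact p.Prime] {K : Type u} [Field K] [CharP K p]

/-! ### The modules `V_{1,7}` -/

section V17

variable (hp : p ≠ 2) (a : K)

instance : Module.Finite K (V17 p hp a) :=
  inferInstanceAs (Module.Finite K (ZMod p ⊕ ZMod p →₀ K))

instance : Nontrivial (V17 p hp a) :=
  inferInstanceAs (Nontrivial (ZMod p ⊕ ZMod p →₀ K))

theorem finrank_V17 : Module.finrank K (V17 p hp a) = 2 * p := by
  change Module.finrank K (ZMod p ⊕ ZMod p →₀ K) = 2 * p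
  simp [ZMod.card, two_mul]

/-- The basis vectors of `V_{1,7}`. -/
def e17 (i : ZMod p ⊕ ZMod p) : V17 p hp a := (Finsupp.single i 1 : ZMod p ⊕ ZMod p →₀ K)

/-- The weights of `V_{1,7}`. -/
def wt17 (K : Type u) [Field K] [CharP K p] : ZMod p ⊕ ZMod p → K
  | .inl j => fpCast p K j
  | .inr j => fpCast p K j

theorem span_e17 : Submodule.span K (Set.range (e17 hp a)) = ⊤ := by
  have := (Finsupp.basisSingleOne (R := K) (ι := ZMod p ⊕ ZMod p)).span_eq
  rw [Finsupp.coe_basisSingleOne] at this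
  exact this

theorem y_smul_V17 (w : V17 p hp a) : gen K .y • w = v17y p K w := by
  change v17Rep hp a (gen K .y) w = _
  rw [v17Rep, rep_gen]
  rfl

theorem v17y_single (i : ZMod p ⊕ ZMod p) :
    v17y p K (Finsupp.single i 1) = wt17 K i • Finsupp.single i 1 := by
  rcases i with j | j <;> simp [v17y, wt17]

theorem isHalfChain_e17_inl : IsHalfChain (gv p K) fun j => e17 hp a (.inl j) where
  y_smul j := (y_smul_V17 hp a _).trans (v17y_single (.inl j))
  s_smul j hj := by
    change v17Rep hp a (gen K .s) (Finsupp.single (.inl j) 1) =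
      gv p K (-j) • (Finsupp.single (.inl (-j)) 1 : ZMod p ⊕ ZMod p →₀ K)
    rw [v17Rep, rep_gen]
    by_cases hv : j.val ≤ (p - 1) / 2 <;> simp [cherednikOps, v17s, gv, hj, hv, val_neg_le hp hj]
  A_smul j hj := by
    change v17Rep hp a (sX K) (Finsupp.single (.inl j) 1) =
      (Finsupp.single (.inl (-j - 1)) 1 : ZMod p ⊕ ZMod p →₀ K)
    rw [v17Rep, rep_sX]
    simp [v17A, hj]

theorem isHalfChain_e17_inr : IsHalfChain (gu p K) fun j => e17 hp a (.inr j) where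
  y_smul j := (y_smul_V17 hp a _).trans (v17y_single (.inr j))
  s_smul j hj := by
    change v17Rep hp a (gen K .s) (Finsupp.single (.inr j) 1) =
      gu p K (-j) • (Finsupp.single (.inr (-j)) 1 : ZMod p ⊕ ZMod p →₀ K)
    rw [v17Rep, rep_gen]
    by_cases hv : j.val ≤ (p - 1) / 2 <;> simp [cherednikOps, v17s, gu, hj, hv, val_neg_le hp hj]
  A_smul j hj := by
    change v17Rep hp a (sX K) (Finsupp.single (.inr j) 1) =
      (Finsupp.single (.inr (-j - 1)) 1 : ZMod p ⊕ ZMod p →₀ K)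
    rw [v17Rep, rep_sX]
    simp [v17A, hj]

theorem y_e17_inl_zero : gen K .y • e17 hp a (.inl 0) = 0 := by
  rw [(isHalfChain_e17_inl hp a).y_smul, map_zero, zero_smul]

theorem y_e17_inr_zero : gen K .y • e17 hp a (.inr 0) = 0 := by
  rw [(isHalfChain_e17_inr hp a).y_smul, map_zero, zero_smul]

theorem s_e17_inl_zero : gen K .s • e17 hp a (.inl 0) = e17 hp a (.inl 0) := by
  change v17Rep hp a (gen K .s) (Finsupp.single (.inl 0) 1) =
    (Finsupp.single (.inl 0) 1 : ZMod p ⊕ ZMod p →₀ K)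
  rw [v17Rep, rep_gen]
  simp [cherednikOps, v17s]

theorem s_e17_inr_zero : gen K .s • e17 hp a (.inr 0) =
    a • e17 hp a (.inl 0) - e17 hp a (.inr 0) := by
  change v17Rep hp a (gen K .s) (Finsupp.single (.inr 0) 1) =
    a • (Finsupp.single (.inl 0) 1 : ZMod p ⊕ ZMod p →₀ K) - Finsupp.single (.inr 0) 1
  rw [v17Rep, rep_gen]
  simp [cherednikOps, v17s]

theorem A_e17_inl_half : sX K • e17 hp a (.inl ((p - 1) / 2 : ℕ)) =
    e17 hp a (.inr ((p - 1) / 2 : ℕ)) := by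
  change v17Rep hp a (sX K) (Finsupp.single (.inl ((p - 1) / 2 : ℕ)) 1) =
    (Finsupp.single (.inr ((p - 1) / 2 : ℕ)) 1 : ZMod p ⊕ ZMod p →₀ K)
  rw [v17Rep, rep_sX]
  simp [v17A]

theorem A_e17_inr_half : sX K • e17 hp a (.inr ((p - 1) / 2 : ℕ)) =
    e17 hp a (.inl ((p - 1) / 2 : ℕ)) := by
  rw [← A_e17_inl_half, A_A]

theorem s_X_pow_e17_inl_zero : gen K .s • gen K .X ^ p • e17 hp a (.inl 0) =
    -e17 hp a (.inr 0) := by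
  apply X_pow_injective (K := K) ((p - 1) / 2)
  have hv := (isHalfChain_e17_inl hp a).X_pow_half_smul hp
  have hu := (isHalfChain_e17_inr hp a).X_pow_half_smul hp
  rw [← A_X_pow_half hp, hv, smul_comm', A_e17_inl_half, smul_neg, hu, halfProd_gu hp, neg_smul,
    neg_neg]

theorem s_X_pow_e17_inr_zero : gen K .s • gen K .X ^ p • e17 hp a (.inr 0) =
    -e17 hp a (.inl 0) := by
  apply X_pow_injective (K := K) ((p - 1) / 2)
  have hv := (isHalfChain_e17_inl hp a).X_pow_half_smul hp
  have hu := (isHalfChain_e17_inr hp a).X_pow_half_smul hp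
  rw [← A_X_pow_half hp, hu, smul_comm', A_e17_inr_half, smul_neg, hv, halfProd_gu hp, neg_smul]

theorem exists_weight_V17 {w : V17 p hp a} {β : K} (hw0 : w ≠ 0) (hw : gen K .y • w = β • w) :
    ∃ j, fpCast p K j = β := by
  let w' : ZMod p ⊕ ZMod p →₀ K := w
  have hw' : v17y p K w' = β • w' := (y_smul_V17 hp a w).symm.trans hw
  obtain ⟨i, hi⟩ := Finsupp.ne_iff.1 (show w' ≠ 0 from hw0)
  have h := weight_eq_of_apply_ne_zero v17y_single hw' hi
  rcases i with j | j <;> exact ⟨j, h⟩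

theorem eq_add_e17 {w : V17 p hp a} (hw : gen K .y • w = 0) :
    ∃ b c : K, w = b • e17 hp a (.inl 0) + c • e17 hp a (.inr 0) := by
  let w' : ZMod p ⊕ ZMod p →₀ K := w
  have hw' : v17y p K w' = (0 : K) • w' :=
    (y_smul_V17 hp a w).symm.trans (hw.trans (zero_smul K w).symm)
  have hwt {i : ZMod p ⊕ ZMod p} (hi : w' i ≠ 0) := weight_eq_of_apply_ne_zero v17y_single hw' hi
  refine ⟨w' (.inl 0), w' (.inr 0), ?_⟩
  change w' = w' (.inl 0) • (Finsupp.single (.inl 0) 1 : ZMod p ⊕ ZMod p →₀ K) +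
    w' (.inr 0) • (Finsupp.single (.inr 0) 1 : ZMod p ⊕ ZMod p →₀ K)
  ext i
  rcases i with j | j <;> by_cases hj : j = 0
  · subst hj; simp
  · have : w' (.inl j) = 0 := by
      by_contra h
      exact hj ((map_eq_zero _).1 (hwt h))
    simp [this, Ne.symm hj]
  · subst hj; simp
  · have : w' (.inr j) = 0 := by
      by_contra h
      exact hj ((map_eq_zero _).1 (hwt h))
    simp [this, Ne.symm hj]

theorem add_e17_ne_zero {b c : K} (h : b ≠ 0 ∨ c ≠ 0) :
    b • e17 hp a (.inl 0) + c • e17 hp a (.inr 0) ≠ 0 := fun h0 => by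
  have h0' : b • (Finsupp.single (.inl 0) 1 : ZMod p ⊕ ZMod p →₀ K) +
    c • (Finsupp.single (.inr 0) 1 : ZMod p ⊕ ZMod p →₀ K) = 0 := h0
  have h1 := DFunLike.congr_fun h0' (.inl 0)
  have h2 := DFunLike.congr_fun h0' (.inr 0)
  simp at h1 h2
  exact h.elim (fun h => h h1) fun h => h h2

/-- On weight `0`, `-s X ^ p` swaps `v_0` and `u_0`, so a stable line would be spanned by `u_0 +
v_0` or `u_0 - v_0`. Applying `s + 1` to these gives `(a + 2) v_0` and `(a - 2) v_0`. -/
theorem e17_zero_mem_of_mem {a : K} (ha : a ≠ 2) (ha' : a ≠ -2) {N : Submodule (H K) (V17 p hp a)}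
    {b c : K} (h : b ≠ 0 ∨ c ≠ 0)
    (hw : b • e17 hp a (.inl 0) + c • e17 hp a (.inr 0) ∈ N) : e17 hp a (.inl 0) ∈ N := by
  have hswap : b • e17 hp a (.inr 0) + c • e17 hp a (.inl 0) ∈ N := by
    have := neg_mem (N.smul_mem (gen K .s) (N.smul_mem (gen K .X ^ p) hw))
    rw [smul_add, smul_add, smul_comm' _ b, smul_comm' _ b, smul_comm' _ c, smul_comm' _ c,
      s_X_pow_e17_inl_zero, s_X_pow_e17_inr_zero] at this
    convert this using 1
    module
  -- Eliminating `u_0` between the vector and its swap.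
  have hdiff : (b * b - c * c) • e17 hp a (.inl 0) ∈ N := by
    have := sub_mem (smul_mem_of_mem N b hw) (smul_mem_of_mem N c hswap)
    convert this using 1
    module
  by_cases hbc : b * b - c * c = 0
  · have hfac : (b - c) * (b + c) = 0 := by linear_combination hbc
    rcases mul_eq_zero.1 hfac with h1 | h1
    · obtain rfl : b = c := sub_eq_zero.1 h1
      have hb : b ≠ 0 := by simpa using h
      rw [← smul_add] at hw
      have hw' := mem_of_smul_mem N hb hw
      have hs := add_mem (N.smul_mem (gen K .s) hw') hw'
      rw [smul_add, s_e17_inl_zero, s_e17_inr_zero] at hs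
      refine mem_of_smul_mem N (c := a + 2) (fun h => ha' (by linear_combination h)) ?_
      convert hs using 1
      module
    · obtain rfl : b = -c := eq_neg_of_add_eq_zero_left h1
      have hc : c ≠ 0 := by simpa using h
      have hw' : e17 hp a (.inr 0) - e17 hp a (.inl 0) ∈ N := by
        refine mem_of_smul_mem N hc ?_
        convert hw using 1
        module
      have hs := add_mem (N.smul_mem (gen K .s) hw') hw'
      rw [smul_sub, s_e17_inl_zero, s_e17_inr_zero] at hs
      refine mem_of_smul_mem N (c := a - 2) (fun h => ha (by linear_combination h)) ?_
      convert hs using 1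
      module
  · exact mem_of_smul_mem N hbc hdiff

theorem isSimpleModule_V17 [IsAlgClosed K] {a : K} (ha : a ≠ 2) (ha' : a ≠ -2) :
    IsSimpleModule (H K) (V17 p hp a) := by
  refine isSimpleModule_of_weight fun N β w hw hw0 hwy => ?_
  obtain ⟨j, rfl⟩ := exists_weight_V17 hp a hw0 hwy
  have hne : gen K .X ^ (-j).val • w ≠ 0 := X_pow_ne_zero _ hw0
  obtain ⟨b, c, he⟩ := eq_add_e17 hp a (exists_weight_zero hwy)
  have hbc : b ≠ 0 ∨ c ≠ 0 := by
    by_contra! h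
    rw [he, h.1, h.2] at hne
    simp at hne
  have hv := e17_zero_mem_of_mem hp ha ha' hbc (he ▸ N.smul_mem _ hw)
  have hu : e17 hp a (.inr 0) ∈ N := by
    have := neg_mem (N.smul_mem (gen K .s) (N.smul_mem (gen K .X ^ p) hv))
    rwa [s_X_pow_e17_inl_zero, neg_neg] at this
  refine eq_top_of_basis_mem (span_e17 hp a) ?_
  rintro (j | j)
  · exact (isHalfChain_e17_inl hp a).mem hp (gv_ne_zero hp) hv j
  · exact (isHalfChain_e17_inr hp a).mem hp (gu_ne_zero hp) hu j

theorem isEmpty_V16_equiv_V17 (c θ : ℤˣ) : IsEmpty (V16 p K hp c θ ≃ₗ[H K] V17 p hp a) := by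
  refine ⟨fun e => ?_⟩
  have h := (e.restrictScalars K).finrank_eq
  rw [finrank_V16, finrank_V17] at h
  have := (Fact.out : p.Prime).pos
  omega

/-- For `a = 2` the vector `u_0 - v_0`, and for `a = -2` the vector `u_0 + v_0`, is a common
eigenvector of `s` and `s X ^ p`. It yields a nonzero map from some `V_{1,6}`, which simplicity
would make an isomorphism between dimensions `p` and `2p`. -/
theorem isSimpleModule_V17_iff [IsAlgClosed K] :
    IsSimpleModule (H K) (V17 p hp a) ↔ a ≠ 2 ∧ a ≠ -2 := by
  refine ⟨fun hsimple => ?_, fun h => isSimpleModule_V17 hp h.1 h.2⟩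
  have hfalse (θ : ℤˣ) (b : K) (hb : b ≠ 0) (hy : ∀ w : V17 p hp a,
      w = b • e17 hp a (.inl 0) + (1 : K) • e17 hp a (.inr 0) →
        gen K .s • w = (((-1 : ℤˣ) : ℤ) : K) • w ∧
          gen K .s • gen K .X ^ p • w = ((θ : ℤ) : K) • w) : False := by
    obtain ⟨h1, h2⟩ := hy _ rfl
    have := isSimpleModule_V16 (K := K) hp (-1) θ
    obtain ⟨φ, hφ⟩ := exists_hom_V16 hp (-1) θ
      (by rw [smul_add, smul_comm', smul_comm', y_e17_inl_zero, y_e17_inr_zero, smul_zero,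
        smul_zero, add_zero]) h1 h2
    obtain ⟨e⟩ := nonempty_equiv_of_hom φ (hφ ▸ add_e17_ne_zero hp a (Or.inl hb))
    exact (isEmpty_V16_equiv_V17 hp a (-1) θ).false e
  refine ⟨fun ha => ?_, fun ha => ?_⟩
  · refine hfalse 1 (-1) (neg_ne_zero.2 one_ne_zero) ?_
    rintro w rfl
    simp only [smul_add, smul_comm', s_e17_inl_zero, s_e17_inr_zero, s_X_pow_e17_inl_zero,
      s_X_pow_e17_inr_zero, Units.val_neg, Units.val_one, Int.cast_neg, Int.cast_one]
    subst ha
    constructor <;> module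
  · refine hfalse (-1) 1 one_ne_zero ?_
    rintro w rfl
    simp only [smul_add, smul_comm', s_e17_inl_zero, s_e17_inr_zero, s_X_pow_e17_inl_zero,
      s_X_pow_e17_inr_zero, Units.val_neg, Units.val_one, Int.cast_neg, Int.cast_one]
    subst ha
    constructor <;> module

/-- Up to scalars `v_0` is the only `s`-fixed vector of weight `0`, so an isomorphism preserves its
line, and `(s + 1) s X ^ p v_0 = -a v_0` recovers `a`. Simplicity is not used, so `a = ±2` is
covered. -/
theorem nonempty_V17_equiv_iff (a' : K) :
    Nonempty (V17 p hp a ≃ₗ[H K] V17 p hp a') ↔ a = a' := by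
  constructor
  · rintro ⟨e⟩
    have hK (r : K) (w : V17 p hp a) : e (r • w) = r • e w := map_smul_field e.toLinearMap r w
    have hrel (a : K) : gen K .s • gen K .s • gen K .X ^ p • e17 hp a (.inl 0) +
        gen K .s • gen K .X ^ p • e17 hp a (.inl 0) = (-a) • e17 hp a (.inl 0) := by
      rw [s_X_pow_e17_inl_zero, smul_neg, s_e17_inr_zero]
      module
    have hy : gen K .y • e (e17 hp a (.inl 0)) = 0 := by
      rw [← map_smul, y_e17_inl_zero, map_zero]
    obtain ⟨b, c, he⟩ := eq_add_e17 hp a' hy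
    have hs := congrArg e (s_e17_inl_zero hp a)
    rw [map_smul, he, smul_add, smul_comm', smul_comm', s_e17_inl_zero, s_e17_inr_zero] at hs
    -- `s`-invariance of the image reads `c a' v_0 - 2c u_0 = 0`.
    have hc : c = 0 := by
      by_contra hc
      refine add_e17_ne_zero hp a' (b := c * a') (c := -2 * c)
        (Or.inr (mul_ne_zero (neg_ne_zero.2 (two_ne_zero_of_charP K hp)) hc)) ?_
      rw [← sub_eq_zero] at hs
      rw [← hs]
      module
    have hne : e (e17 hp a (.inl 0)) ≠ 0 := by
      intro h
      have h1 := e.map_eq_zero_iff.1 h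
      refine add_e17_ne_zero hp a (b := 1) (c := 0) (Or.inl one_ne_zero) ?_
      rw [h1]
      module
    rw [hc, zero_smul, add_zero] at he
    have h1 := congrArg e (hrel a)
    have h2 := congrArg (b • ·) (hrel a')
    simp only [map_add, map_smul, hK, he, smul_add, smul_comm'] at h1 h2
    rw [h2, smul_comm] at h1
    exact (neg_injective (smul_left_injective K (he ▸ hne) h1)).symm
  · rintro rfl
    exact ⟨LinearEquiv.refl _ _⟩

variable {M : Type v} [AddCommGroup M] [Module K M] [Module (H K) M] [IsScalarTower K (H K) M]

/-- A pair of vectors of weight `0` on which `s` and `s X ^ p` act as they do on `v_0, u_0` defines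
a homomorphism. -/
theorem exists_hom_V17 {v w : M} (hyv : gen K .y • v = 0) (hyw : gen K .y • w = 0)
    (hv : gen K .s • v = v) (hw : gen K .s • w = a • v - w)
    (hX : gen K .s • gen K .X ^ p • v = -w) :
    ∃ φ : V17 p hp a →ₗ[H K] M, φ (e17 hp a (.inl 0)) = v := by
  let f : ZMod p → M := halfChain (gv p K) v
  let f' : ZMod p → M := halfChain (gu p K) w
  have hf0 : f 0 = v := halfChain_zero _ _
  have hf0' : f' 0 = w := halfChain_zero _ _
  have hf : IsHalfChain (gv p K) f := isHalfChain_halfChain hp (gv_mul hp) hyv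
  have hf' : IsHalfChain (gu p K) f' := isHalfChain_halfChain hp (gu_mul hp) hyw
  -- The minus sign in `hX` cancels the one relating the two half-products.
  have hA : sX K • f ((p - 1) / 2 : ℕ) = f' ((p - 1) / 2 : ℕ) := by
    have h := hf.X_pow_half_smul hp
    have h' := hf'.X_pow_half_smul hp
    have h2 := A_X_pow_half (K := K) hp (f 0)
    rw [hf0, hX, ← hf0, ← hf0', smul_neg, h, h', smul_comm', halfProd_gu hp, neg_smul, neg_neg]
      at h2
    exact smul_right_injective M (halfProd_ne_zero (gv_ne_zero hp)) h2
  have he := isHalfChain_e17_inl hp a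
  have he' := isHalfChain_e17_inr hp a
  let φ : (ZMod p ⊕ ZMod p →₀ K) →ₗ[K] M := Finsupp.linearCombination K (Sum.elim f f')
  have hφ (i : ZMod p ⊕ ZMod p) : φ (Finsupp.single i 1) = Sum.elim f f' i := by
    simp [φ]
  have key (i j : ZMod p ⊕ ZMod p) (b : K) (h : H K)
      (h1 : h • e17 hp a i = b • e17 hp a j) (h2 : h • Sum.elim f f' i = b • Sum.elim f f' j) :
      φ (v17Rep hp a h (Finsupp.single i 1)) = h • φ (Finsupp.single i 1) := by
    have h1' : v17Rep hp a h (Finsupp.single i 1) =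
      b • (Finsupp.single j 1 : ZMod p ⊕ ZMod p →₀ K) := h1
    rw [h1', map_smul, hφ, hφ, h2]
  have key' (i j : ZMod p ⊕ ZMod p) (h : H K)
      (h1 : h • e17 hp a i = e17 hp a j) (h2 : h • Sum.elim f f' i = Sum.elim f f' j) :
      φ (v17Rep hp a h (Finsupp.single i 1)) = h • φ (Finsupp.single i 1) :=
    key i j 1 h (h1.trans (one_smul _ _).symm) (h2.trans (one_smul _ _).symm)
  have hint := intertwines (v17Rep hp a) φ
    (by
      rintro (j | j) <;> by_cases hj : j = 0
      · subst hj
        exact key' _ _ _ (s_e17_inl_zero hp a) (by simp [hf0, hv])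
      · exact key _ _ _ _ (he.s_smul j hj) (hf.s_smul j hj)
      · subst hj
        have h1 : v17Rep hp a (gen K .s) (Finsupp.single (.inr 0) 1) =
          a • (Finsupp.single (.inl 0) 1 : ZMod p ⊕ ZMod p →₀ K) - Finsupp.single (.inr 0) 1 :=
          s_e17_inr_zero hp a
        rw [h1, map_sub, map_smul, hφ, hφ]
        simp [hf0, hf0', hw]
      · exact key _ _ _ _ (he'.s_smul j hj) (hf'.s_smul j hj))
    (by
      rintro (j | j) <;> by_cases hj : j = ((p - 1) / 2 : ℕ)
      · subst hj
        exact key' _ _ _ (A_e17_inl_half hp a) hA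
      · exact key' _ _ _ (he.A_smul j hj) (hf.A_smul j hj)
      · subst hj
        refine key' _ _ _ (A_e17_inr_half hp a) ?_
        simp only [Sum.elim_inl, Sum.elim_inr]
        rw [← hA, A_A]
      · exact key' _ _ _ (he'.A_smul j hj) (hf'.A_smul j hj))
    (by
      rintro (j | j)
      · exact key _ _ _ _ (he.y_smul j) (hf.y_smul j)
      · exact key _ _ _ _ (he'.y_smul j) (hf'.y_smul j))
  exact ⟨{ toFun := φ, map_add' := φ.map_add, map_smul' := hint }, (hφ (.inl 0)).trans hf0⟩

end V17

/-! ### Modules with a weight in the prime field -/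

section Classification

/-- After moving to weight `0`, `w` and `s w` are eigenvectors of `X ^ p` for `l` and `l⁻¹`. If
these agree, `X ^ p` is a sign on their span and an `s`-eigenvector there gives a `V_{1,6}`;
otherwise `w + s w` plays the role of `v_0` in a `V_{1,7}`. -/
theorem exists_equiv_V16_or_V17 [IsAlgClosed K] (hp : p ≠ 2) (V : Type v) [AddCommGroup V]
    [Module K V] [Module (H K) V] [IsScalarTower K (H K) V] [IsSimpleModule (H K) V]
    [Module.Finite K V] {w : V} (hw0 : w ≠ 0) {j : ZMod p}
    (hw : gen K .y • w = fpCast p K j • w) :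
    (∃ c θ : ℤˣ, Nonempty (V ≃ₗ[H K] V16 p K hp c θ)) ∨
      (∃ a : K, a ≠ 2 ∧ a ≠ -2 ∧ Nonempty (V ≃ₗ[H K] V17 p hp a)) := by
  obtain ⟨l, w, hw0, hy, hl⟩ := exists_X_pow_eigenvector p (β := (0 : K))
    (X_pow_ne_zero (K := K) (-j).val hw0) (by rw [exists_weight_zero hw, zero_smul])
  rw [zero_smul] at hy
  have hl0 : l ≠ 0 := by
    rintro rfl
    exact X_pow_ne_zero (K := K) p hw0 (hl.trans (zero_smul _ _))
  have hys : gen K .y • gen K .s • w = 0 := by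
    have := y_s (β := (0 : K)) (hy.trans (zero_smul _ _).symm)
    rwa [neg_zero, zero_smul] at this
  have hls : gen K .X ^ p • gen K .s • w = l⁻¹ • gen K .s • w := by
    have h := congrArg (gen K .s • ·) hl
    simp only [s_X_pow, smul_comm'] at h
    have h' := congrArg (gen K .X ^ p • ·) h
    simp only [X_pow_Xinv_pow, smul_comm'] at h'
    conv_rhs => rw [h', inv_smul_smul₀ hl0]
  have hs0 : gen K .s • w ≠ 0 := fun h => hw0 (by rw [← s_s (K := K) w, h, smul_zero])
  by_cases hll : l = l⁻¹
  · left
    obtain ⟨ε, hε⟩ : ∃ ε : ℤˣ, ((ε : ℤ) : K) = l := by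
      have h : (l - 1) * (l + 1) = 0 := by
        have := mul_inv_cancel₀ hl0
        rw [← hll] at this
        linear_combination this
      rcases mul_eq_zero.1 h with h | h
      · exact ⟨1, by simp [sub_eq_zero.1 h]⟩
      · exact ⟨-1, by simp [eq_neg_of_add_eq_zero_left h]⟩
    have hfinish (c : ℤˣ) (hne : w + ((c : ℤ) : K) • gen K .s • w ≠ 0) :
        ∃ c θ : ℤˣ, Nonempty (V ≃ₗ[H K] V16 p K hp c θ) := by
      have hs : gen K .s • (w + ((c : ℤ) : K) • gen K .s • w) =
          ((c : ℤ) : K) • (w + ((c : ℤ) : K) • gen K .s • w) := by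
        rw [smul_add, smul_comm', s_s, smul_add, smul_smul, signCast_mul_self, one_smul, add_comm]
      have hX : gen K .X ^ p • (w + ((c : ℤ) : K) • gen K .s • w) =
          l • (w + ((c : ℤ) : K) • gen K .s • w) := by
        rw [smul_add, smul_comm', hls, ← hll, hl]
        generalize gen K .s • w = z
        module
      -- `s` acts by `c` and `X ^ p` by `ε`, so `s X ^ p` acts by `ε c`.
      refine ⟨c, ε * c, ?_⟩
      have := isSimpleModule_V16 (K := K) hp c (ε * c)
      obtain ⟨φ, hφ⟩ := exists_hom_V16 hp c (ε * c)
        (by rw [smul_add, smul_comm', hy, hys, smul_zero, add_zero]) hs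
        (by
          rw [hX, smul_comm', hs, smul_smul, ← hε]
          push_cast
          rfl)
      exact (nonempty_equiv_of_hom φ (hφ ▸ hne)).map LinearEquiv.symm
    -- `w + s w` and `w - s w` cannot both vanish, since `2 ≠ 0`.
    by_cases h1 : w + (((1 : ℤˣ) : ℤ) : K) • gen K .s • w = 0
    · refine hfinish (-1) fun h2 => hw0 ?_
      simp only [Units.val_neg, Units.val_one, Int.cast_neg, Int.cast_one] at h1 h2
      have h3 : (2 : K) • w = 0 := by
        rw [← add_zero (0 : V)]
        nth_rw 1 [← h1]
        rw [← h2]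
        generalize gen K .s • w = z
        module
      exact (smul_eq_zero.1 h3).resolve_left (two_ne_zero_of_charP K hp)
    · exact hfinish 1 h1
  · right
    -- If `-(l + l⁻¹) = 2ε` with `ε² = 1`, then `(l + ε)² = 0`, so `l = -ε = l⁻¹`.
    have hsum (ε : K) (hε : ε * ε = 1) : -(l + l⁻¹) ≠ 2 * ε := fun h => by
      have h1 : (l + ε) * (l + ε) = 0 := by
        have := mul_inv_cancel₀ hl0
        linear_combination -l * h + hε - this
      have h2 : l = -ε := eq_neg_of_add_eq_zero_left (mul_self_eq_zero.1 h1)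
      exact hll (eq_inv_of_mul_eq_one_left (by rw [h2, neg_mul_neg, hε]))
    have ha : -(l + l⁻¹) ≠ 2 := by simpa using hsum 1 (by norm_num)
    have ha' : -(l + l⁻¹) ≠ -2 := by simpa using hsum (-1) (by norm_num)
    have hne : w + gen K .s • w ≠ 0 := fun h => by
      have h1 : gen K .s • w = -w := eq_neg_of_add_eq_zero_right h
      rw [h1, smul_neg, hl, smul_neg, neg_inj] at hls
      exact hll (smul_left_injective K hw0 hls)
    refine ⟨_, ha, ha', ?_⟩
    have := isSimpleModule_V17 hp ha ha'
    -- The second vector is forced: `u_0 = -s X ^ p v_0` with `v_0 = w + s w`.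
    obtain ⟨φ, hφ⟩ := exists_hom_V17 hp (-(l + l⁻¹)) (v := w + gen K .s • w)
      (w := -(l • gen K .s • w + l⁻¹ • w))
      (by rw [smul_add, hy, hys, add_zero])
      (by rw [smul_neg, smul_add, smul_comm', smul_comm', hy, hys, smul_zero, smul_zero, add_zero,
        neg_zero])
      (by rw [smul_add, s_s, add_comm])
      (by
        rw [smul_neg, smul_add, smul_comm', smul_comm', s_s]
        generalize gen K .s • w = z
        module)
      (by rw [smul_add, hl, hls, smul_add, smul_comm', smul_comm', s_s, neg_neg])
    exact (nonempty_equiv_of_hom φ (hφ ▸ hne)).map LinearEquiv.symm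

end Classification

end RankOne

end

noncomputable section

namespace RankOne

variable {p : ℕ} [Fact p.Prime] {K : Type u} [Field K] [CharP K p]

/-! ### Comparison of the families -/

theorem e17_ne_zero (hp : p ≠ 2) (a : K) (i : ZMod p ⊕ ZMod p) : e17 hp a i ≠ 0 := fun h => by
  have h' : (Finsupp.single i 1 : ZMod p ⊕ ZMod p →₀ K) = 0 := h
  simp at h'

/-- Weight `0` occurs in the other two families but not among `±μ + 𝔽_p`. -/
theorem isEmpty_V11_equiv {μ d : K} (hμ : μ ∉ Set.range (fpCast p K)) (hd : d ≠ 0) (hp : p ≠ 2)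
    {M : Type v} [AddCommGroup M] [Module (H K) M] {m : M} (hm : m ≠ 0)
    (hy : gen K .y • m = 0) : IsEmpty (V11 p μ d hμ hd ≃ₗ[H K] M) := by
  refine ⟨fun e => ?_⟩
  have hne : e.symm m ≠ 0 := fun h => hm (e.symm.map_eq_zero_iff.1 h)
  have hy' : gen K .y • e.symm m = (0 : K) • e.symm m := by
    rw [← map_smul, hy, map_zero, zero_smul]
  obtain ⟨i, -, -, hi, -⟩ := eq_smul_e11 hμ hd hp hne hy'
  rcases i with j | j
  · exact μ_add_ne hμ j hi
  · exact neg_μ_add_ne hμ j hi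

end RankOne

end

/-! ### The classification -/

theorem proposition2p5 {K : Type u} [Field K] [IsAlgClosed K] (p : ℕ) [Fact p.Prime] [CharP K p]
    (hp : p ≠ 2) :
    -- the three families: irreducibility and dimension
    (∀ (μ d : K) (hμ : μ ∉ Set.range (fpCast p K)) (hd : d ≠ 0),
      IsSimpleModule (TrigCherednik (1 : K) 0) (V11 p μ d hμ hd) ∧
        Module.finrank K (V11 p μ d hμ hd) = 2 * p) ∧
    (∀ c θ : ℤˣ,
      IsSimpleModule (TrigCherednik (1 : K) 0) (V16 p K hp c θ) ∧
        Module.finrank K (V16 p K hp c θ) = p) ∧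
    (∀ a : K,
      (IsSimpleModule (TrigCherednik (1 : K) 0) (V17 p hp a) ↔ a ≠ 2 ∧ a ≠ -2) ∧
        Module.finrank K (V17 p hp a) = 2 * p) ∧
    -- every irreducible module belongs to one of the families
    (∀ (V : Type v) [AddCommGroup V] [Module (TrigCherednik (1 : K) 0) V],
      IsSimpleModule (TrigCherednik (1 : K) 0) V →
        (∃ (μ d : K) (hμ : μ ∉ Set.range (fpCast p K)) (hd : d ≠ 0),
          Nonempty (V ≃ₗ[TrigCherednik (1 : K) 0] V11 p μ d hμ hd)) ∨
        (∃ c θ : ℤˣ, Nonempty (V ≃ₗ[TrigCherednik (1 : K) 0] V16 p K hp c θ)) ∨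
        (∃ a : K, a ≠ 2 ∧ a ≠ -2 ∧
          Nonempty (V ≃ₗ[TrigCherednik (1 : K) 0] V17 p hp a))) ∧
    -- isomorphisms within each family
    (∀ (μ d : K) (hμ : μ ∉ Set.range (fpCast p K)) (hd : d ≠ 0)
      (μ' d' : K) (hμ' : μ' ∉ Set.range (fpCast p K)) (hd' : d' ≠ 0),
      Nonempty (V11 p μ d hμ hd ≃ₗ[TrigCherednik (1 : K) 0] V11 p μ' d' hμ' hd') ↔
        (μ' - μ ∈ Set.range (fpCast p K) ∧ d' = d) ∨
        (μ' + μ ∈ Set.range (fpCast p K) ∧ d * d' = ∏ c : ZMod p, -(μ + fpCast p K c) ^ 2)) ∧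
    (∀ c θ c' θ' : ℤˣ,
      Nonempty (V16 p K hp c θ ≃ₗ[TrigCherednik (1 : K) 0] V16 p K hp c' θ') ↔
        c = c' ∧ θ = θ') ∧
    (∀ a a' : K,
      Nonempty (V17 p hp a ≃ₗ[TrigCherednik (1 : K) 0] V17 p hp a') ↔ a = a') ∧
    -- modules of different families are never isomorphic
    (∀ (μ d : K) (hμ : μ ∉ Set.range (fpCast p K)) (hd : d ≠ 0) (c θ : ℤˣ),
      IsEmpty (V11 p μ d hμ hd ≃ₗ[TrigCherednik (1 : K) 0] V16 p K hp c θ)) ∧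
    (∀ (μ d : K) (hμ : μ ∉ Set.range (fpCast p K)) (hd : d ≠ 0) (a : K),
      IsEmpty (V11 p μ d hμ hd ≃ₗ[TrigCherednik (1 : K) 0] V17 p hp a)) ∧
    (∀ (c θ : ℤˣ) (a : K),
      IsEmpty (V16 p K hp c θ ≃ₗ[TrigCherednik (1 : K) 0] V17 p hp a)) := by
  refine ⟨fun μ d hμ hd => ⟨RankOne.isSimpleModule_V11 hμ hd hp, RankOne.finrank_V11 hμ hd⟩,
    fun c θ => ⟨RankOne.isSimpleModule_V16 hp c θ, RankOne.finrank_V16 hp c θ⟩,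
    fun a => ⟨RankOne.isSimpleModule_V17_iff hp a, RankOne.finrank_V17 hp a⟩, ?_,
    fun μ d hμ hd μ' d' hμ' hd' => RankOne.nonempty_V11_equiv_iff hμ hd hp hμ' hd',
    fun c θ c' θ' => RankOne.nonempty_V16_equiv_iff hp c θ c' θ',
    fun a a' => RankOne.nonempty_V17_equiv_iff hp a a',
    fun μ d hμ hd c θ => RankOne.isEmpty_V11_equiv hμ hd hp (RankOne.e16_ne_zero hp c θ 0)
      (RankOne.y_e16_zero hp c θ),
    fun μ d hμ hd a => RankOne.isEmpty_V11_equiv hμ hd hp (RankOne.e17_ne_zero hp a (.inl 0))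
      (RankOne.y_e17_inl_zero hp a),
    fun c θ a => RankOne.isEmpty_V16_equiv_V17 hp a c θ⟩
  intro V _ _ _
  -- `V` is only given as a module over the algebra; its `K`-structure is restored through the
  -- scalars.
  let _ : Module K V := Module.compHom V (algebraMap K (TrigCherednik (1 : K) 0))
  have : IsScalarTower K (TrigCherednik (1 : K) 0) V :=
    ⟨fun r h v => by rw [Algebra.smul_def, mul_smul]; rfl⟩
  have := IsSimpleModule.nontrivial (TrigCherednik (1 : K) 0) V
  have := RankOne.finite_of_isSimpleModule_H (K := K) p V
  obtain ⟨μ, w, hw0, hw⟩ := RankOne.exists_weight (K := K) (M := V)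
  by_cases hμ : μ ∈ Set.range (fpCast p K)
  · obtain ⟨j, rfl⟩ := hμ
    exact Or.inr (RankOne.exists_equiv_V16_or_V17 hp V hw0 hw)
  · obtain ⟨d, hd, e⟩ := RankOne.exists_equiv_V11 hp V hμ hw0 hw
    exact Or.inl ⟨μ, d, hμ, hd, e⟩
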